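/- **Networks.** Let $V$ be a finite set of nodes and $\Delta\in\mathbb N$. A *snapshot* is an undirected simple graph on $V$ in which every edge occupies one of the ports $0,\dots,\Delta-1$ at each of its endpoints and every port carries at most one edge (so all degrees are at most $\Delta$). A *dynamic network* is an arbitrary sequence $(G_t)_{t\ge 0}$ of snapshots, one for each stage ("arbitrary edge dynamics"). $N_t(u)$ is the set of ports of $u$ that carry an edge in $G_t$. Port $\ell$ of $u$ is *disconnected* at the beginning of stage $t\ge 1$ if in $G_{t-1}$ it was joined to some port $m$ of some node $w$ and in $G_t$ it is not joined to that port of $w$. **Algorithms.** The state of a node consists of a main state, a state for each port, and private memory for each port. An algorithm $\mathcal A=\mathcal A_{sync}$ in the Pull model is a collection of actions $\langle guard\rangle\to\langle operations\rangle$, the same for all nodes. A guard is a predicate of the local state; the operations compute the new local state from the old one and, for each port $\ell$ at which a neighbour is considered, the neighbour's main state and the state of the neighbour's port that is joined to $\ell$. A node is *terminated* if none of its actions is enabled (has a true guard). Fix a set of admissible initial configurations. In a *synchronous execution* of $\mathcal A$ under $(H_i)_{i\ge0}$, started in an admissible configuration, in each step $i$ all nodes simultaneously pull from all their neighbours in $H_i$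 and run one enabled action (a terminated node does nothing). **The synchronizer.** In $\kappa(\mathcal A)$ each node has an $\mathcal A$-state, $\texttt{phase}\in\mathbb N$, $\texttt{synch}\in\{0,1\}$, sets of ports $I,P,F,\tilde D,D$, bits $\ell.\texttt{block}$ and $\ell.\texttt{ack}$ for each port $\ell$, and a place $X(\ell)$ for information pulled through port $\ell$. Initially the $\mathcal A$-states form an admissible configuration, numbers and bits are $0$, sets and $X(\ell)$ are empty. $\textsc{Pull}(\ell)$ returns, for the neighbour $w$ at $\ell$ and the port $m$ of $w$ joined to $\ell$, the $\mathcal A$-main state, the $\mathcal A$-state of port $m$, $\texttt{phase}$, $\texttt{synch}$, $P$, $\tilde D$, $D$ and $m.\texttt{ack}$ of $w$, and the label $\texttt{port}=m$. $\textsc{Block}(\ell)$ sets $m.\texttt{block}=1$ at $w$. There are two actions; $N$ is the set of ports carrying an edge in the current stage. * $\textsc{Handshake}$, enabled if $\texttt{synch}=0$ or $\ell.\texttt{block}=0$ for some $\ell\in P\setminus\tilde D$. If $\texttt{synch}=0$: set $X(\ell)\leftarrow\textsc{Pull}(\ell)$ for $\ell\in N$; $\tilde D\leftarrow\emptyset$;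 let $I$ be the set of $\ell\in N$ such that $X(\ell).\texttt{phase}>\texttt{phase}$, or $X(\ell).\texttt{phase}=\texttt{phase}$, $X(\ell).\texttt{synch}=1$ and ($X(\ell).\texttt{port}\notin X(\ell).P$ or $X(\ell).\texttt{port}\in X(\ell).\tilde D\cup X(\ell).D$); $P\leftarrow N\setminus I$; $\texttt{synch}\leftarrow1$. If $\texttt{synch}=1$: for each $\ell\in P\setminus(\tilde D\cup D)$ set $X(\ell)\leftarrow\textsc{Pull}(\ell)$ if $X(\ell).\texttt{phase}<\texttt{phase}$, and otherwise only $X(\ell).\texttt{ack}\leftarrow\textsc{Pull}(\ell).\texttt{ack}$; then $\tilde D\leftarrow\tilde D\cup D$. In both cases, then, for each $\ell\in P\setminus\tilde D$ with $X(\ell).\texttt{phase}=\texttt{phase}$ and $\ell.\texttt{block}=0$: if $X(\ell).\texttt{ack}=1$, do $\textsc{Block}(\ell)$ and $\ell.\texttt{block}\leftarrow1$; otherwise $\ell.\texttt{ack}\leftarrow1$. * $\textsc{ExecuteSynch}$, enabled if $\texttt{synch}=1$ and $\ell.\texttt{block}=1$ for all $\ell\in P\setminus\tilde D$. Set $F\leftarrow\{\ell\in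 P:\ell.\texttt{block}=1\}$; run one enabled action of $\mathcal A$ (if there is one) on the $\mathcal A$-state with respect to the $\mathcal A$-information in $X(\ell)$, $\ell\in F$; $\texttt{phase}\leftarrow\texttt{phase}+1$; $\texttt{synch}\leftarrow0$; set all $\texttt{ack}$ and $\texttt{block}$ bits to $0$. **Semi-synchronous executions.** In stage $t$ of a *semi-synchronous execution* of $\kappa(\mathcal A)$ under $(G_t)_{t\ge0}$, first each port disconnected at the beginning of the stage is added to the set $D$ of its node. Then the scheduler activates an arbitrary set of enabled nodes; these concurrently read the states of the beginning of the stage, run an enabled action, and reset $D$ to $\emptyset$. Concurrent $\textsc{Block}$ operations succeed in writing $1$. The execution is *weakly fair* if every continuously enabled node is eventually activated. A node *ends phase $i$* in the stage in which its $\texttt{phase}$ changes from $i$ to $i+1$. **Correct emulation.** A semi-synchronous execution of $\kappa(\mathcal A)$ and a synchronous execution of $\mathcal A$ *agree* if initially the $\mathcal A$-states coincide and, for every $i\ge0$, every node ends phase $i$ in some stage and its $\mathcal A$-state at the end of phase $i$ equals its state at the end of step $i$ of the synchronous execution. $\kappa(\mathcal A)$ *correctly emulates* $\mathcal A$ if (1)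 for every dynamic network $\mathcal G_{semi}$, every weakly fair semi-synchronous execution of $\kappa(\mathcal A)$ under $\mathcal G_{semi}$ agrees with a synchronous execution of $\mathcal A$ under some dynamic network $\mathcal G_{synch}$; and (2) for every dynamic network $\mathcal G_{synch}$, every synchronous execution of $\mathcal A$ under $\mathcal G_{synch}$ agrees with a weakly fair semi-synchronous execution of $\kappa(\mathcal A)$ under some dynamic network $\mathcal G_{semi}$. **Termination.** A synchronous execution of $\mathcal A$ (a semi-synchronous execution of $\kappa(\mathcal A)$) *terminates in finite time* if at some step (stage) the states (the $\mathcal A$-states) of all nodes are terminated. **Statement.** For all $V$, $\Delta$, $\mathcal A$ and every set of admissible initial configurations: every synchronous execution of $\mathcal A$, under every dynamic network, terminates in finite time if and only if $\kappa(\mathcal A)$ correctly emulates $\mathcal A$ and every weakly fair semi-synchronous execution of $\kappa(\mathcal A)$, under every dynamic network, terminates in finite time. -/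

import Mathlib

open scoped Classical

universe u v

/-! ## Dynamic networks with port labels -/

/-- A snapshot of the network: an undirected simple graph on `V` in which every edge occupies one
of the `Δ` ports `0, …, Δ - 1` at each of its two endpoints, and every port carries at most one
edge; in particular all degrees are at most `Δ`.
`link u ℓ = some (w, m)` means that port `ℓ` of `u` is joined by an edge to port `m` of `w`. -/
structure Snapshot (V : Type v) (Δ : ℕ) where
  link : V → Fin Δ → Option (V × Fin Δ)
  symm : ∀ u ℓ w m, link u ℓ = some (w, m) → link w m = some (u, ℓ)
  loopless : ∀ u ℓ m, link u ℓ ≠ some (u, m)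
  simple : ∀ u w ℓ ℓ' m m', link u ℓ = some (w, m) → link u ℓ' = some (w, m') → ℓ = ℓ'

/-- A dynamic network: an arbitrary sequence of snapshots, one for every stage. Nothing relates the
snapshots of different stages to each other (arbitrary edge dynamics). -/
abbrev DynamicNetwork (V : Type v) (Δ : ℕ) := ℕ → Snapshot V Δ

/-- The ports of `u` whose edge is disconnected at the beginning of stage `t`. -/
noncomputable def DynamicNetwork.disconnected {V : Type v} {Δ : ℕ} (G : DynamicNetwork V Δ) :
    ℕ → V → Finset (Fin Δ)
  | 0, _ => ∅
  | t + 1, u => Finset.univ.filter fun ℓ =>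
      ((G t).link u ℓ).isSome ∧ (G (t + 1)).link u ℓ ≠ (G t).link u ℓ

/-! ## Algorithms in the pull model and their synchronous executions -/

/-- The memory of a node: a main state, a state for each port, and for each port
a private area in which pulled information may be kept. -/
structure NodeState (Δ : ℕ) (Main Port Nbr : Type u) where
  main : Main
  port : Fin Δ → Port
  nbr : Fin Δ → Nbr

/-- An anonymous algorithm in the pull model for nodes with `Δ` ports: a collection of actions
`guard → operations`. A guard is a predicate of the local memory. The operations compute the new
memory from the old one and from the pulled information: for every port `ℓ`, either nothing (no
neighbour considered at `ℓ`) or the main state of the neighbour at `ℓ` together with the state of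
that port of the neighbour through which it is joined to `ℓ`. -/
structure PullAlgorithm (Δ : ℕ) where
  Main : Type u
  Port : Type u
  Nbr : Type u
  Act : Type u
  guard : Act → NodeState Δ Main Port Nbr → Prop
  op : Act → NodeState Δ Main Port Nbr → (Fin Δ → Option (Main × Port)) →
    NodeState Δ Main Port Nbr

namespace PullAlgorithm

variable {Δ : ℕ} (A : PullAlgorithm.{u} Δ)

/-- Local states of the algorithm. -/
abbrev State := NodeState Δ A.Main A.Port A.Nbr

/-- A node has terminated when none of its actions is enabled. -/
def Halted (s : A.State) : Prop := ∀ a, ¬ A.guard a s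

/-- One local step: run one enabled action with respect to the pulled information `view`;
a node without enabled actions does nothing. -/
def LocalStep (s : A.State) (view : Fin Δ → Option (A.Main × A.Port)) (s' : A.State) : Prop :=
  (∃ a, A.guard a s ∧ s' = A.op a s view) ∨ (A.Halted s ∧ s' = s)

/-- What `u` pulls through its ports in the snapshot `H` if the configuration is `c`. -/
def view {V : Type v} (H : Snapshot V Δ) (c : V → A.State) (u : V) :
    Fin Δ → Option (A.Main × A.Port) :=
  fun ℓ => (H.link u ℓ).map fun wm => ((c wm.1).main, (c wm.1).port wm.2)

/-- `c` is a synchronous execution of `A` under the dynamic network `H`, started in one of the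
admissible initial configurations `Init`: in every step all nodes act simultaneously.
`c i` is the configuration at the beginning of step `i`. -/
def IsSyncExecution {V : Type v} (Init : Set (V → A.State)) (H : DynamicNetwork V Δ)
    (c : ℕ → V → A.State) : Prop :=
  c 0 ∈ Init ∧ ∀ i u, A.LocalStep (c i u) (A.view (H i) (c i) u) (c (i + 1) u)

end PullAlgorithm

/-! ## The synchronizer -/

/-- What a node obtains by pulling from a neighbour: the neighbour's main variables, and its
variables of the port through which it is joined to the pulling node. -/
structure Pulled {Δ : ℕ} (A : PullAlgorithm.{u} Δ) where
  algMain : A.Main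
  algPort : A.Port
  phase : ℕ
  synch : Bool
  P : Finset (Fin Δ)
  Dt : Finset (Fin Δ)
  D : Finset (Fin Δ)
  ack : Bool
  port : Fin Δ

/-- The memory of a node that runs the synchronizer on top of `A`. `alg` is its `A`-state, `Dt` is
the set of ports disconnected throughout the current phase, `D` is the set maintained by the
disconnection detector, and `block` holds the multi-writer 1-bit registers of the ports. -/
structure KState {Δ : ℕ} (A : PullAlgorithm.{u} Δ) where
  alg : A.State
  phase : ℕ
  synch : Bool
  I : Finset (Fin Δ)
  P : Finset (Fin Δ)
  F : Finset (Fin Δ)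
  Dt : Finset (Fin Δ)
  D : Finset (Fin Δ)
  block : Fin Δ → Bool
  ack : Fin Δ → Bool
  X : Fin Δ → Option (Pulled A)

namespace KState

variable {Δ : ℕ} {A : PullAlgorithm.{u} Δ}

/-- Initial memory over an initial `A`-state. -/
def init (s : A.State) : KState A where
  alg := s
  phase := 0
  synch := false
  I := ∅
  P := ∅
  F := ∅
  Dt := ∅
  D := ∅
  block := fun _ => false
  ack := fun _ => false
  X := fun _ => none

/-- The information that a node in state `s` makes available through its port `m`. -/
def exposed (s : KState A) (m : Fin Δ) : Pulled A where
  algMain := s.alg.main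
  algPort := s.alg.port m
  phase := s.phase
  synch := s.synch
  P := s.P
  Dt := s.Dt
  D := s.D
  ack := s.ack m
  port := m

/-- Guard of the action `Handshake`. -/
def HandshakeGuard (s : KState A) : Prop :=
  s.synch = false ∨ ∃ ℓ ∈ s.P \ s.Dt, s.block ℓ = false

/-- Guard of the action `ExecuteSynch`. -/
def ExecuteGuard (s : KState A) : Prop :=
  s.synch = true ∧ ∀ ℓ ∈ s.P \ s.Dt, s.block ℓ = true

/-- A node is enabled if one of the two actions is. -/
def Enabled (s : KState A) : Prop := s.HandshakeGuard ∨ s.ExecuteGuard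

/-- The neighbour that exposes `x` is invalid for a node whose phase is `phase`. -/
def Invalid (phase : ℕ) (x : Pulled A) : Prop :=
  (x.phase = phase ∧ x.synch = true ∧ (x.port ∉ x.P ∨ x.port ∈ x.Dt ∪ x.D)) ∨ x.phase > phase

/-- First part of `Handshake` if `synch = 0`; `pull ℓ` is what can be pulled through port `ℓ` in
the current stage (`none` if no edge is present at `ℓ`). -/
noncomputable def beginPhase (s : KState A) (pull : Fin Δ → Option (Pulled A)) : KState A :=
  let N : Finset (Fin Δ) := Finset.univ.filter fun ℓ => (pull ℓ).isSome
  let I : Finset (Fin Δ) := N.filter fun ℓ => ∃ x, pull ℓ = some x ∧ Invalid s.phase x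
  { s with
    X := fun ℓ => if ℓ ∈ N then pull ℓ else s.X ℓ
    Dt := ∅
    I := I
    P := N \ I
    synch := true }

/-- The new value of `X(ℓ)` for a valid persistent port: pull everything if the last pulled phase
is smaller than the own phase, and only the variable `ack` otherwise. -/
def refresh (phase : ℕ) (old new : Option (Pulled A)) : Option (Pulled A) :=
  match old, new with
  | some x, some y => if x.phase < phase then some y else some { x with ack := y.ack }
  | _, _ => old

/-- First part of `Handshake` if `synch = 1`. -/
noncomputable def continuePhase (s : KState A) (pull : Fin Δ → Option (Pulled A)) : KState A :=
  { s with
    X := fun ℓ => if ℓ ∈ s.P \ (s.Dt ∪ s.D) then refresh s.phase (s.X ℓ) (pull ℓ) else s.X ℓ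
    Dt := s.Dt ∪ s.D }

/-- First part of `Handshake`. -/
noncomputable def handshakePull (s : KState A) (pull : Fin Δ → Option (Pulled A)) : KState A :=
  if s.synch = false then s.beginPhase pull else s.continuePhase pull

/-- The ports considered in the final loop of `Handshake` (run in the state after its first
part): valid persistent ports with `X(ℓ).phase = phase` and `ℓ.block = 0`. -/
noncomputable def loopPorts (s : KState A) : Finset (Fin Δ) :=
  (s.P \ s.Dt).filter fun ℓ => (∃ x, s.X ℓ = some x ∧ x.phase = s.phase) ∧ s.block ℓ = false

/-- The ports of the final loop with `X(ℓ).ack = 1`: there both `Block(ℓ)`, which writes 1 to the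
block register at the other end of the edge, and `ℓ.block = 1` are executed. -/
noncomputable def blockPorts (s : KState A) : Finset (Fin Δ) :=
  s.loopPorts.filter fun ℓ => ∃ x, s.X ℓ = some x ∧ x.ack = true

/-- The local effect of the final loop of `Handshake`; `ack` is set on the other loop ports. -/
noncomputable def handshakeLoop (s : KState A) : KState A :=
  { s with
    block := fun ℓ => if ℓ ∈ s.blockPorts then true else s.block ℓ
    ack := fun ℓ => if ℓ ∈ s.loopPorts \ s.blockPorts then true else s.ack ℓ }

/-- The local effect of the action `Handshake`. -/
noncomputable def handshake (s : KState A) (pull : Fin Δ → Option (Pulled A)) : KState A :=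
  (s.handshakePull pull).handshakeLoop

/-- The ports through which `Handshake` executes `Block(ℓ)`. -/
noncomputable def handshakeWrites (s : KState A) (pull : Fin Δ → Option (Pulled A)) :
    Finset (Fin Δ) :=
  (s.handshakePull pull).blockPorts

/-- The set computed at the beginning of `ExecuteSynch`: the ports of `P` with `ℓ.block = 1`. -/
noncomputable def finalPorts (s : KState A) : Finset (Fin Δ) :=
  s.P.filter fun ℓ => s.block ℓ = true

/-- The stored `A`-information about the neighbours at the ports of `finalPorts`. -/
noncomputable def emulatedView (s : KState A) : Fin Δ → Option (A.Main × A.Port) :=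
  fun ℓ => if ℓ ∈ s.finalPorts then (s.X ℓ).map fun x => (x.algMain, x.algPort) else none

/-- The local effect of the action `ExecuteSynch` (a relation, since `A` may have several enabled
actions). -/
def Execute (s s' : KState A) : Prop :=
  ∃ r, A.LocalStep s.alg s.emulatedView r ∧
    s' = { s with
      F := s.finalPorts
      alg := r
      phase := s.phase + 1
      synch := false
      ack := fun _ => false
      block := fun _ => false }

end KState

/-! ## Semi-synchronous executions of the synchronizer -/

section SemiSynchronous

variable {V : Type v} {Δ : ℕ} {A : PullAlgorithm.{u} Δ}

/-- What `u` can pull through its ports in the snapshot `G` if the configuration is `s`. -/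
def pullFrom (G : Snapshot V Δ) (s : V → KState A) (u : V) : Fin Δ → Option (Pulled A) :=
  fun ℓ => (G.link u ℓ).map fun wm => (s wm.1).exposed wm.2

/-- The disconnection detectors record the ports in `disc`. -/
noncomputable def detect (disc : V → Finset (Fin Δ)) (c : V → KState A) : V → KState A :=
  fun u => { c u with D := (c u).D ∪ disc u }

/-- In the current stage, some activated node that runs `Handshake` executes a `Block` on the
register of port `ℓ` of `u`. -/
def BlockedBy (G : Snapshot V Δ) (active : Set V) (s : V → KState A) (u : V) (ℓ : Fin Δ) :
    Prop :=
  ∃ w m, G.link u ℓ = some (w, m) ∧ w ∈ active ∧ (s w).HandshakeGuard ∧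
    m ∈ (s w).handshakeWrites (pullFrom G s w)

/-- Effect of a stage on the memory of `u`, apart from the `Block` operations of its neighbours.
If `u` is activated it runs an enabled action and then its set `D` is reset. -/
def OwnStep (G : Snapshot V Δ) (active : Set V) (s : V → KState A) (u : V) (r : KState A) :
    Prop :=
  (u ∉ active ∧ r = s u) ∨
  (u ∈ active ∧ ∃ q,
    (((s u).HandshakeGuard ∧ q = (s u).handshake (pullFrom G s u)) ∨
      ((s u).ExecuteGuard ∧ (s u).Execute q)) ∧
    r = { q with D := ∅ })

/-- One stage, in the snapshot `G`: all activated nodes read the states `s` of the beginning of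
the stage and act concurrently. Concurrent `Block` operations succeed in writing 1. -/
def StageStep (G : Snapshot V Δ) (active : Set V) (s s' : V → KState A) : Prop :=
  ∀ u, ∃ r, OwnStep G active s u r ∧
    s' u = { r with block := fun ℓ => r.block ℓ || decide (BlockedBy G active s u ℓ) }

/-- `c` is a semi-synchronous execution of the synchronizer on top of `A` under the dynamic network
`G`, in which the scheduler activates the set `active t` of nodes in stage `t`. `c t` is the
configuration at the beginning of stage `t`. -/
def IsSemiExecution (Init : Set (V → A.State)) (G : DynamicNetwork V Δ) (active : ℕ → Set V)
    (c : ℕ → V → KState A) : Prop :=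
  (∃ c₀ ∈ Init, c 0 = fun u => KState.init (c₀ u)) ∧
  (∀ t, ∀ u ∈ active t, (c t u).Enabled) ∧
  ∀ t, StageStep (G t) (active t) (detect (G.disconnected t) (c t)) (c (t + 1))

/-- Weak fairness: every continuously enabled node is eventually activated. -/
def WeaklyFair (active : ℕ → Set V) (c : ℕ → V → KState A) : Prop :=
  ∀ u t, (∀ t' ≥ t, (c t' u).Enabled) → ∃ t' ≥ t, u ∈ active t'

/-- Node `u` ends phase `i` in stage `t`. -/
def EndsPhase (c : ℕ → V → KState A) (u : V) (i t : ℕ) : Prop :=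
  (c t u).phase = i ∧ (c (t + 1) u).phase = i + 1

/-- The execution `c` of the synchronizer and the synchronous execution `d` agree: they start in
the same `A`-states, every node ends every phase `i`, and its `A`-state at the end of phase `i` is
its state at the end of step `i` of `d`. -/
def SameOutcome (c : ℕ → V → KState A) (d : ℕ → V → A.State) : Prop :=
  (∀ u, (c 0 u).alg = d 0 u) ∧
  ∀ i u, (∃ t, EndsPhase c u i t) ∧
    ∀ t, EndsPhase c u i t → (c (t + 1) u).alg = d (i + 1) u

/-- The synchronizer correctly emulates `A`: each of its weakly fair semi-synchronous executions
agrees with a synchronous execution of `A` under some dynamic network, and each synchronous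
execution of `A` agrees with a weakly fair semi-synchronous execution of the synchronizer under
some dynamic network. -/
def CorrectlyEmulates (A : PullAlgorithm.{u} Δ) (Init : Set (V → A.State)) : Prop :=
  (∀ (G : DynamicNetwork V Δ) (active : ℕ → Set V) (c : ℕ → V → KState A),
    IsSemiExecution Init G active c → WeaklyFair active c →
    ∃ (H : DynamicNetwork V Δ) (d : ℕ → V → A.State),
      A.IsSyncExecution Init H d ∧ SameOutcome c d) ∧
  (∀ (H : DynamicNetwork V Δ) (d : ℕ → V → A.State),
    A.IsSyncExecution Init H d →
    ∃ (G : DynamicNetwork V Δ) (active : ℕ → Set V) (c : ℕ → V → KState A),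
      IsSemiExecution Init G active c ∧ WeaklyFair active c ∧ SameOutcome c d)

/-- Every synchronous execution of `A`, under every dynamic network, reaches in finite time a
configuration in which all nodes have terminated. -/
def SyncAlwaysTerminates (A : PullAlgorithm.{u} Δ) (Init : Set (V → A.State)) : Prop :=
  ∀ (H : DynamicNetwork V Δ) (d : ℕ → V → A.State), A.IsSyncExecution Init H d →
    ∃ i, ∀ u, A.Halted (d i u)

/-- Every weakly fair semi-synchronous execution of the synchronizer on top of `A`, under every
dynamic network, reaches in finite time a configuration in which the `A`-states of all nodes have
terminated. -/
def SemiAlwaysTerminates (A : PullAlgorithm.{u} Δ) (Init : Set (V → A.State)) : Prop :=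
  ∀ (G : DynamicNetwork V Δ) (active : ℕ → Set V) (c : ℕ → V → KState A),
    IsSemiExecution Init G active c → WeaklyFair active c →
    ∃ t, ∀ u, A.Halted (c t u).alg

end SemiSynchronous

/-! The heart of the proof is that `κ(A)` emulates `A` correctly whether or not `A` terminates; the
equivalence of the two termination statements then follows by comparing phases with steps.

Safety rests on one invariant, `HandshakeInv`, about edges whose disconnection has not been
detected. `Block` is executed only after the neighbour's `ack` has been read. Such a neighbour is in
the same phase, with both block bits still 0, so it cannot be running `ExecuteSynch` in that stage.
Hence the two block bits of an edge are set in the same stage, by nodes of equal phase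
(`block_event`), and both survive to the end of that phase even if the edge disappears meanwhile. So
the ports with `block = 1` at the end of phase `i` pair up symmetrically, although the nodes end the
phase in different stages. They form a snapshot, and the information stored at them is that of phase
`i`. These snapshots are the network of a synchronous execution (`final_symm`, `emulates`).

For progress, suppose that a node stays in phase `i` forever. Some port of it waits forever, so its
edge is never disconnected, and the neighbour there is stuck in the same phase. Fairness lets one
end acknowledge and the other end answer with `Block`, a contradiction (`exists_le_phase`).

Conversely, a synchronous step is reproduced by three stages in one constant snapshot: all nodes
pull and acknowledge, then all execute `Block`, then all run `ExecuteSynch`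
(`roundExecution_phase`).

In agreeing executions the `A`-state of a node in phase `i` is its synchronous state at step `i`,
and terminated states never change. Since `V` is finite, a common bound on stages or on phases
transfers termination in either direction. -/

section Synchronizer

variable {V : Type v} {Δ : ℕ} {A : PullAlgorithm.{u} Δ}

/-! ## One stage of the synchronizer -/

namespace KState

/-- Port `ℓ` belongs to the current phase and no disconnection of it was detected. -/
def Live (s : KState A) (ℓ : Fin Δ) : Prop :=
  s.synch = true ∧ ℓ ∈ s.P ∧ ℓ ∉ s.Dt ∧ ℓ ∉ s.D

/-- The two guards are complementary, so weak fairness amounts to activating every node infinitely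
often. -/
theorem enabled (s : KState A) : s.Enabled := by
  unfold Enabled HandshakeGuard ExecuteGuard
  grind

theorem not_handshakeGuard_of_executeGuard {s : KState A} (h : s.ExecuteGuard) :
    ¬ s.HandshakeGuard := by
  unfold HandshakeGuard ExecuteGuard at *
  grind

end KState

/-- In the current stage `u` executes `Block` through its port `ℓ`. -/
def Writes (G : Snapshot V Δ) (active : Set V) (s : V → KState A) (u : V) (ℓ : Fin Δ) : Prop :=
  u ∈ active ∧ (s u).HandshakeGuard ∧ ℓ ∈ (s u).handshakeWrites (pullFrom G s u)

theorem blockedBy_iff {G : Snapshot V Δ} {active : Set V} {s : V → KState A} {u : V} {ℓ : Fin Δ} :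
    BlockedBy G active s u ℓ ↔ ∃ w m, G.link u ℓ = some (w, m) ∧ Writes G active s w m :=
  Iff.rfl

theorem blockedBy_iff_of_link {G : Snapshot V Δ} {active : Set V} {s : V → KState A} {u w : V}
    {ℓ m : Fin Δ} (h : G.link u ℓ = some (w, m)) :
    BlockedBy G active s u ℓ ↔ Writes G active s w m := by
  rw [blockedBy_iff]
  simp [h]

/-- In the current stage `u` runs `ExecuteSynch`. -/
def Executes (active : Set V) (s : V → KState A) (u : V) : Prop :=
  u ∈ active ∧ (s u).ExecuteGuard

theorem pullFrom_of_link {G : Snapshot V Δ} {s : V → KState A} {u w : V} {ℓ m : Fin Δ}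
    (h : G.link u ℓ = some (w, m)) : pullFrom G s u ℓ = some ((s w).exposed m) := by
  simp [pullFrom, h]

/-- The possible effects of a stage on a node. -/
theorem StageStep.node_cases {G : Snapshot V Δ} {active : Set V} {s s' : V → KState A}
    (h : StageStep G active s s') (u : V) :
    (u ∉ active ∧
      s' u = { s u with block := fun ℓ => (s u).block ℓ || decide (BlockedBy G active s u ℓ) }) ∨
    (u ∈ active ∧ (s u).HandshakeGuard ∧
      s' u = { (s u).handshake (pullFrom G s u) with
        D := ∅
        block := fun ℓ => ((s u).handshake (pullFrom G s u)).block ℓ ||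
          decide (BlockedBy G active s u ℓ) }) ∨
    (Executes active s u ∧ ∃ r, A.LocalStep (s u).alg (s u).emulatedView r ∧
      s' u = { s u with
        F := (s u).finalPorts
        alg := r
        phase := (s u).phase + 1
        synch := false
        ack := fun _ => false
        D := ∅
        block := fun ℓ => decide (BlockedBy G active s u ℓ) }) := by
  obtain ⟨r, hr, hs⟩ := h u
  rcases hr with ⟨hu, rfl⟩ | ⟨hu, q, ⟨hg, rfl⟩ | ⟨hg, r', hl, rfl⟩, rfl⟩
  · exact Or.inl ⟨hu, hs⟩
  · exact Or.inr (Or.inl ⟨hu, hg, hs⟩)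
  · refine Or.inr (Or.inr ⟨⟨hu, hg⟩, r', hl, ?_⟩)
    simpa using hs

section Stage

variable {G : Snapshot V Δ} {active : Set V} {s s' : V → KState A}

theorem Executes.not_writes {u : V} (h : Executes active s u) (ℓ : Fin Δ) :
    ¬ Writes G active s u ℓ :=
  fun hw => KState.not_handshakeGuard_of_executeGuard h.2 hw.2.1

theorem KState.handshake_phase (s : KState A) (p : Fin Δ → Option (Pulled A)) :
    (s.handshake p).phase = s.phase := by
  unfold handshake handshakeLoop handshakePull beginPhase continuePhase
  split_ifs <;> rfl

theorem KState.handshake_alg (s : KState A) (p : Fin Δ → Option (Pulled A)) :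
    (s.handshake p).alg = s.alg := by
  unfold handshake handshakeLoop handshakePull beginPhase continuePhase
  split_ifs <;> rfl

theorem KState.handshake_synch (s : KState A) (p : Fin Δ → Option (Pulled A)) :
    (s.handshake p).synch = true := by
  unfold handshake handshakeLoop handshakePull beginPhase continuePhase
  split_ifs with h
  · rfl
  · simpa using h

theorem KState.handshakePull_block (s : KState A) (p : Fin Δ → Option (Pulled A)) :
    (s.handshakePull p).block = s.block := by
  unfold handshakePull beginPhase continuePhase
  split_ifs <;> rfl

theorem KState.handshakePull_ack (s : KState A) (p : Fin Δ → Option (Pulled A)) :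
    (s.handshakePull p).ack = s.ack := by
  unfold handshakePull beginPhase continuePhase
  split_ifs <;> rfl

theorem KState.handshakePull_phase (s : KState A) (p : Fin Δ → Option (Pulled A)) :
    (s.handshakePull p).phase = s.phase := by
  unfold handshakePull beginPhase continuePhase
  split_ifs <;> rfl

theorem StageStep.phase_of_executes (h : StageStep G active s s') {u : V}
    (hu : Executes active s u) :
    (s' u).phase = (s u).phase + 1 ∧ (s' u).synch = false := by
  rcases h.node_cases u with ⟨h1, h2⟩ | ⟨h1, h2, h3⟩ | ⟨h1, r, -, h2⟩
  · exact absurd hu.1 h1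
  · exact absurd h2 (KState.not_handshakeGuard_of_executeGuard hu.2)
  · simp [h2]

theorem StageStep.phase_of_not_executes (h : StageStep G active s s') {u : V}
    (hu : ¬ Executes active s u) :
    (s' u).phase = (s u).phase ∧ (s' u).alg = (s u).alg := by
  rcases h.node_cases u with ⟨h1, h2⟩ | ⟨h1, h2, h3⟩ | ⟨h1, r, -, h2⟩
  · simp [h2]
  · simp [h3, KState.handshake_phase, KState.handshake_alg]
  · exact absurd h1 hu

theorem StageStep.synch_iff (h : StageStep G active s s') (u : V) :
    (s' u).synch = true ↔ ¬ Executes active s u ∧ ((s u).synch = true ∨ u ∈ active) := by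
  rcases h.node_cases u with ⟨h1, h2⟩ | ⟨h1, h2, h3⟩ | ⟨h1, r, -, h2⟩
  · have : ¬ Executes active s u := fun h => h1 h.1
    simp [h2, this, h1]
  · have : ¬ Executes active s u :=
      fun h => KState.not_handshakeGuard_of_executeGuard h.2 h2
    simp [h3, this, h1, KState.handshake_synch]
  · simp [h2, h1]

theorem StageStep.block_iff (h : StageStep G active s s') (u : V) (ℓ : Fin Δ) :
    (s' u).block ℓ = true ↔ ((s u).block ℓ = true ∧ ¬ Executes active s u) ∨
      Writes G active s u ℓ ∨ BlockedBy G active s u ℓ := by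
  rcases h.node_cases u with ⟨h1, h2⟩ | ⟨h1, h2, h3⟩ | ⟨h1, r, -, h2⟩
  · have : ¬ Executes active s u := fun h => h1 h.1
    have : ¬ Writes G active s u ℓ := fun h => h1 h.1
    simp [*]
  · have : ¬ Executes active s u :=
      fun h => KState.not_handshakeGuard_of_executeGuard h.2 h2
    simp only [h3, this, Writes, h1, h2, KState.handshake, KState.handshakeLoop,
      KState.handshakeWrites, KState.handshakePull_block]
    by_cases hb : ℓ ∈ ((s u).handshakePull (pullFrom G s u)).blockPorts <;> simp [hb]
  · have := h1.not_writes (G := G) ℓ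
    simp [*]

/-- Resetting `D` after a `Handshake` loses nothing: with `synch = 1` the action has moved `D` into
`Dt`, and with `synch = 0` a new phase begins. Thus a port becomes live only when its phase begins
and, until the phase ends, ceases to be so only through a detection. -/
theorem StageStep.live_iff (h : StageStep G active s s') (u : V) (ℓ : Fin Δ) :
    (s' u).Live ℓ ↔ ((s u).Live ℓ ∧ ¬ Executes active s u) ∨
      (u ∈ active ∧ (s u).synch = false ∧ ∃ w m, G.link u ℓ = some (w, m) ∧
        ¬ KState.Invalid (s u).phase ((s w).exposed m)) := by
  rcases h.node_cases u with ⟨h1, h2⟩ | ⟨h1, h2, h3⟩ | ⟨h1, r, -, h2⟩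
  · have : ¬ Executes active s u := fun h => h1 h.1
    simp [h2, this, h1, KState.Live]
  · have : ¬ Executes active s u :=
      fun h => KState.not_handshakeGuard_of_executeGuard h.2 h2
    by_cases hs : (s u).synch = false
    · simp only [KState.Live, h3, KState.handshake, KState.handshakeLoop, KState.handshakePull,
        hs, KState.beginPhase, this, h1]
      rcases hl : G.link u ℓ with _ | ⟨w, m⟩ <;> simp [pullFrom, hl]
    · simp only [KState.Live, h3, KState.handshake, KState.handshakeLoop, KState.handshakePull,
        hs, KState.continuePhase, this, h1]
      simp
  · simp only [KState.Live, h1, h2]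
    simp [h1.2.1]

end Stage

/-! ## The invariant of the handshakes -/

/-- The invariant of the configuration `s` in the snapshot `G`. Here `base u` is the snapshot seen
from `u` at the beginning of its current phase, and `Seen w n a` says that `w` has been in phase
`n` with `A`-state `a`. -/
structure HandshakeInv (G : Snapshot V Δ) (base : V → Fin Δ → Option (V × Fin Δ))
    (Seen : V → ℕ → A.State → Prop) (s : V → KState A) : Prop where
  seen_self : ∀ u, Seen u (s u).phase (s u).alg
  le_of_seen : ∀ u n a, Seen u n a → n ≤ (s u).phase
  idle : ∀ u ℓ, (s u).synch = false → (s u).block ℓ = false ∧ (s u).ack ℓ = false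
  mem : ∀ u ℓ, (s u).synch = true → ℓ ∈ (s u).P → ∃ x w m, (s u).X ℓ = some x ∧
    base u ℓ = some (w, m) ∧ ((s u).Live ℓ → G.link u ℓ = some (w, m)) ∧
    ((s u).block ℓ = true ∨ (s u).ack ℓ = true → x.phase = (s u).phase) ∧
    ∃ a, Seen w x.phase a ∧ x.algMain = a.main ∧ x.algPort = a.port m
  -- The last four clauses compare the two ends of an edge that is live at `u`. According to whether
  -- `w` is ahead of `u`, in the same phase with `synch = 1`, or not yet there, the bit of `u` is 1,
  -- equal to that of `w`, or 0.
  live_symm : ∀ u ℓ w m, G.link u ℓ = some (w, m) → (s u).Live ℓ → (s w).phase = (s u).phase →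
    (s w).synch = true → (s w).Live m
  block_of_lt : ∀ u ℓ w m, G.link u ℓ = some (w, m) → (s u).Live ℓ → (s u).phase < (s w).phase →
    (s u).block ℓ = true
  block_eq : ∀ u ℓ w m, G.link u ℓ = some (w, m) → (s u).Live ℓ → (s w).phase = (s u).phase →
    (s w).synch = true → (s u).block ℓ = (s w).block m
  block_of_behind : ∀ u ℓ w m, G.link u ℓ = some (w, m) → (s u).Live ℓ →
    ((s w).phase < (s u).phase ∨ (s w).phase = (s u).phase ∧ (s w).synch = false) →
    (s u).block ℓ = false

section Invariant

variable {G : Snapshot V Δ} {active : Set V} {base : V → Fin Δ → Option (V × Fin Δ)}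
  {Seen : V → ℕ → A.State → Prop} {s s' : V → KState A}

theorem KState.refresh_some (n : ℕ) (x y : Pulled A) :
    KState.refresh n (some x) (some y) =
      if x.phase < n then some y else some { x with ack := y.ack } := rfl

/-- The ports of the final loop of `Handshake` are live, or become so by this very action. -/
theorem HandshakeInv.loopPorts_cases (h : HandshakeInv G base Seen s) {u : V} {ℓ : Fin Δ}
    (hℓ : ℓ ∈ ((s u).handshakePull (pullFrom G s u)).loopPorts) :
    (s u).block ℓ = false ∧ ∃ w m x, G.link u ℓ = some (w, m) ∧
      ((s u).handshakePull (pullFrom G s u)).X ℓ = some x ∧ (s w).phase = (s u).phase ∧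
      x.phase = (s u).phase ∧ x.ack = (s w).ack m ∧
      ((s u).Live ℓ ∨
        (s u).synch = false ∧ ¬ KState.Invalid (s u).phase ((s w).exposed m)) := by
  simp only [KState.loopPorts, Finset.mem_filter, KState.handshakePull_block,
    KState.handshakePull_phase] at hℓ
  obtain ⟨hP, ⟨x, hx, hxp⟩, hb⟩ := hℓ
  refine ⟨hb, ?_⟩
  by_cases hs : (s u).synch = false
  · simp only [KState.handshakePull, hs, KState.beginPhase, if_true] at hP hx ⊢
    rcases hl : G.link u ℓ with _ | ⟨w, m⟩
    · simp [pullFrom, hl] at hP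
    · simp only [pullFrom, hl] at hP hx ⊢
      simp only [Finset.mem_sdiff] at hP
      simp [hl] at hP hx
      subst hx
      refine ⟨w, m, _, rfl, by simp [hl], hxp, hxp, rfl, Or.inr ⟨trivial, hP⟩⟩
  · have hs' : (s u).synch = true := by simpa using hs
    simp only [KState.handshakePull, hs', KState.continuePhase, Bool.true_eq_false, if_false]
      at hP hx ⊢
    simp only [Finset.mem_sdiff, Finset.mem_union, not_or] at hP
    have hlive : (s u).Live ℓ := ⟨hs', hP.1, hP.2.1, hP.2.2⟩
    obtain ⟨y, w, m, hy, -, hlink, -, a, ha, -⟩ := h.mem u ℓ hs' hP.1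
    have hl := hlink hlive
    have hmem : ℓ ∈ (s u).P \ ((s u).Dt ∪ (s u).D) := by simp [hP]
    have hle : y.phase ≤ (s w).phase := h.le_of_seen _ _ _ ha
    -- A neighbour that was ahead would have left the block bit of `u` at 1. With `hle`, the phase
    -- of `w` is squeezed between the stored phase and that of `u`.
    have hwle : (s w).phase ≤ (s u).phase := by
      by_contra hlt
      have := h.block_of_lt u ℓ w m hl hlive (by omega)
      simp [hb] at this
    rw [if_pos hmem, hy, pullFrom_of_link hl, KState.refresh_some] at hx
    refine ⟨w, m, x, hl, ?_, ?_, hxp, ?_, Or.inl hlive⟩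
    · rw [if_pos hmem, hy, pullFrom_of_link hl, KState.refresh_some, hx]
    · split_ifs at hx with hlt
      · cases hx; exact hxp
      · cases hx
        simp only at hxp
        omega
    · split_ifs at hx <;> cases hx <;> rfl

/-- A `Block` is only executed on a live port of a neighbour in the same phase; the block bits at
both ends of the edge are still 0. -/
theorem HandshakeInv.writes (h : HandshakeInv G base Seen s) {u w : V} {ℓ m : Fin Δ}
    (hl : G.link u ℓ = some (w, m)) (hw : Writes G active s u ℓ) :
    (s w).Live m ∧ (s w).phase = (s u).phase ∧ (s u).block ℓ = false ∧ (s w).block m = false ∧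
      (s w).ack m = true ∧ ((s u).Live ℓ ∨
        (s u).synch = false ∧ ¬ KState.Invalid (s u).phase ((s w).exposed m)) := by
  obtain ⟨-, -, hw⟩ := hw
  simp only [KState.handshakeWrites, KState.blockPorts, Finset.mem_filter] at hw
  obtain ⟨hw, x, hx, hack⟩ := hw
  obtain ⟨hb, w', m', x', hl', hx', hp, -, hxa, hc⟩ := h.loopPorts_cases hw
  rw [hl] at hl'
  cases hl'
  rw [hx] at hx'
  cases hx'
  rw [hxa] at hack
  have hsw : (s w).synch = true := by
    by_contra hs
    have := (h.idle w m (by simpa using hs)).2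
    simp [hack] at this
  rcases hc with hc | ⟨hc, hv⟩
  · refine ⟨h.live_symm u ℓ w m hl hc hp hsw, hp, hb, ?_, hack, Or.inl hc⟩
    rw [← h.block_eq u ℓ w m hl hc hp hsw, hb]
  · have hlive : (s w).Live m := by
      simp only [KState.Invalid, KState.exposed, hp, hsw] at hv
      simp at hv
      exact ⟨hsw, hv.1, hv.2⟩
    exact ⟨hlive, hp, hb, h.block_of_behind w m u ℓ (G.symm _ _ _ _ hl) hlive
      (Or.inr ⟨hp.symm, hc⟩), hack, Or.inr ⟨hc, hv⟩⟩

theorem HandshakeInv.writes_exists (h : HandshakeInv G base Seen s) {u : V} {ℓ : Fin Δ}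
    (hw : Writes G active s u ℓ) : ∃ w m, G.link u ℓ = some (w, m) := by
  obtain ⟨-, -, hw⟩ := hw
  simp only [KState.handshakeWrites, KState.blockPorts, Finset.mem_filter] at hw
  obtain ⟨-, w, m, -, hl, -⟩ := h.loopPorts_cases hw.1
  exact ⟨w, m, hl⟩

/-- The guard of `ExecuteSynch` requires bit 1 at every live port, whereas the target of a `Block`
is live with bit 0. Hence no `Block` coincides with the reset at the end of the target's phase. -/
theorem HandshakeInv.not_executes_of_blockedBy (h : HandshakeInv G base Seen s) {u : V} {ℓ : Fin Δ}
    (hb : BlockedBy G active s u ℓ) :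
    ¬ Executes active s u ∧ (s u).Live ℓ ∧ (s u).block ℓ = false ∧ (s u).ack ℓ = true := by
  obtain ⟨w, m, hl, hw⟩ := hb
  obtain ⟨h1, -, -, h4, h5, -⟩ := h.writes (G.symm _ _ _ _ hl) hw
  refine ⟨fun he => ?_, h1, h4, h5⟩
  have := he.2.2 ℓ (by simp [h1.2.1, h1.2.2.1])
  simp [h4] at this

/-- Block bits are set concurrently at both ends of an edge, by nodes in the same phase. -/
theorem HandshakeInv.block_event (h : HandshakeInv G base Seen s)
    (hstep : StageStep G active s s') {u : V} {ℓ : Fin Δ} (h0 : (s u).block ℓ = false)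
    (h1 : (s' u).block ℓ = true) :
    ∃ w m, G.link u ℓ = some (w, m) ∧ (s w).phase = (s u).phase ∧ (s w).block m = false ∧
      (s' w).block m = true ∧ (s' u).phase = (s u).phase ∧ (s' u).Live ℓ := by
  have key : ∀ u w ℓ m, G.link u ℓ = some (w, m) → Writes G active s u ℓ →
      (s' u).Live ℓ := by
    intro u w ℓ m hl hw
    rw [hstep.live_iff]
    obtain ⟨-, -, -, -, -, hc⟩ := h.writes hl hw
    rcases hc with hc | hc
    · exact Or.inl ⟨hc, fun he => he.not_writes ℓ hw⟩
    · exact Or.inr ⟨hw.1, hc.1, w, m, hl, hc.2⟩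
  rcases (hstep.block_iff u ℓ).1 h1 with h2 | h2 | h2
  · simp [h0] at h2
  · obtain ⟨w, m, hl⟩ := h.writes_exists h2
    obtain ⟨ha, hb, hc, hd, -⟩ := h.writes hl h2
    refine ⟨w, m, hl, hb, hd, ?_, ?_, key _ _ _ _ hl h2⟩
    · exact (hstep.block_iff w m).2 (Or.inr (Or.inr ⟨u, ℓ, G.symm _ _ _ _ hl, h2⟩))
    · exact (hstep.phase_of_not_executes fun he => he.not_writes ℓ h2).1
  · obtain ⟨he, hlive, -⟩ := h.not_executes_of_blockedBy h2
    obtain ⟨w, m, hl, hw⟩ := h2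
    obtain ⟨ha, hb, hc, hd, -⟩ := h.writes (G.symm _ _ _ _ hl) hw
    refine ⟨w, m, hl, hb.symm, hc, (hstep.block_iff w m).2 (Or.inr (Or.inl hw)),
      (hstep.phase_of_not_executes he).1, (hstep.live_iff u ℓ).2 (Or.inl ⟨hlive, he⟩)⟩

end Invariant

/-! ### Preservation of the clauses about block bits and live ports -/

section Preservation

variable {G : Snapshot V Δ} {active : Set V} {base : V → Fin Δ → Option (V × Fin Δ)}
  {Seen : V → ℕ → A.State → Prop} {s s' : V → KState A}

theorem not_invalid_iff {u w : V} {m : Fin Δ} (hp : (s w).phase = (s u).phase) :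
    ¬ KState.Invalid (s u).phase ((s w).exposed m) ↔ ((s w).synch = true → (s w).Live m) := by
  simp only [KState.Invalid, KState.exposed, hp, KState.Live, Finset.mem_union]
  simp
  tauto

theorem phase_le_of_not_invalid {u w : V} {m : Fin Δ}
    (h : ¬ KState.Invalid (s u).phase ((s w).exposed m)) : (s w).phase ≤ (s u).phase := by
  by_contra hlt
  exact h (Or.inr (by simpa [KState.exposed] using hlt))

theorem StageStep.phase_le (h : StageStep G active s s') (u : V) :
    (s u).phase ≤ (s' u).phase ∧ (s' u).phase ≤ (s u).phase + 1 := by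
  by_cases hu : Executes active s u
  · simp [(h.phase_of_executes hu).1]
  · simp [(h.phase_of_not_executes hu).1]

theorem StageStep.not_executes_of_live (h : StageStep G active s s') {u : V} {ℓ : Fin Δ}
    (hl : (s' u).Live ℓ) : ¬ Executes active s u :=
  ((h.synch_iff u).1 hl.1).1

theorem KState.Live.block_of_executes {u : V} {ℓ : Fin Δ} (hl : (s u).Live ℓ)
    (he : Executes active s u) : (s u).block ℓ = true :=
  he.2.2 ℓ (by simp [hl.2.1, hl.2.2.1])

namespace HandshakeInv

/-- The validity test is what makes this work: a node that begins a phase accepts a neighbour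
already in that phase only if the neighbour's port is live. Two nodes that begin concurrently both
read `synch = 0` and accept each other. -/
theorem live_symm_step (h : HandshakeInv G base Seen s) (hstep : StageStep G active s s')
    {u w : V} {ℓ m : Fin Δ} (hl : G.link u ℓ = some (w, m)) (hlive : (s' u).Live ℓ)
    (hp : (s' w).phase = (s' u).phase) (hs : (s' w).synch = true) : (s' w).Live m := by
  have hu := hstep.not_executes_of_live hlive
  obtain ⟨hw, hs⟩ := (hstep.synch_iff w).1 hs
  rw [(hstep.phase_of_not_executes hu).1, (hstep.phase_of_not_executes hw).1] at hp
  rw [hstep.live_iff] at hlive ⊢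
  have hl' := G.symm _ _ _ _ hl
  by_cases hsw : (s w).synch = true
  · refine Or.inl ⟨?_, hw⟩
    rcases hlive with ⟨h1, -⟩ | ⟨-, -, w', m', hl2, hv⟩
    · exact h.live_symm u ℓ w m hl h1 hp hsw
    · rw [hl] at hl2
      cases hl2
      exact (not_invalid_iff hp).1 hv hsw
  · refine Or.inr ⟨hs.resolve_left hsw, by simpa using hsw, u, ℓ, hl', ?_⟩
    rw [not_invalid_iff hp.symm]
    rintro hsu
    rcases hlive with ⟨h1, -⟩ | ⟨-, h2, -⟩
    · exact h1
    · simp [hsu] at h2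

theorem block_of_lt_step (h : HandshakeInv G base Seen s) (hstep : StageStep G active s s')
    {u w : V} {ℓ m : Fin Δ} (hl : G.link u ℓ = some (w, m)) (hlive : (s' u).Live ℓ)
    (hp : (s' u).phase < (s' w).phase) : (s' u).block ℓ = true := by
  have hu := hstep.not_executes_of_live hlive
  rw [(hstep.phase_of_not_executes hu).1] at hp
  rw [hstep.block_iff]
  refine Or.inl ⟨?_, hu⟩
  rw [hstep.live_iff] at hlive
  have hl' := G.symm _ _ _ _ hl
  have hlew := hstep.phase_le w
  have hexec : (s w).phase ≤ (s u).phase → Executes active s w ∧ (s w).phase = (s u).phase := by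
    intro hle
    have he : Executes active s w := by
      by_contra he
      have := (hstep.phase_of_not_executes he).1
      omega
    exact ⟨he, by omega⟩
  -- If `w` overtakes in this very stage, it runs `ExecuteSynch` with bit 1 at `m`, and `block_eq`
  -- carries this bit over to `u`.
  rcases hlive with ⟨h1, -⟩ | ⟨-, h0, w', m', hl2, hv⟩
  · by_cases hlt : (s u).phase < (s w).phase
    · exact h.block_of_lt u ℓ w m hl h1 hlt
    · obtain ⟨he, heq⟩ := hexec (by omega)
      rw [h.block_eq u ℓ w m hl h1 heq he.2.1]
      exact (h.live_symm u ℓ w m hl h1 heq he.2.1).block_of_executes he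
  · rw [hl] at hl2
    cases hl2
    -- Here `u` begins its phase while `w` would be ending it. This is impossible: the port of `w`
    -- is live with `u` not yet in the phase, so its bit is 0.
    obtain ⟨he, heq⟩ := hexec (phase_le_of_not_invalid hv)
    have hlw := (not_invalid_iff heq).1 hv he.2.1
    have h1 := hlw.block_of_executes he
    have h2 := h.block_of_behind w m u ℓ hl' hlw (Or.inr ⟨heq.symm, h0⟩)
    simp [h1] at h2

theorem block_eq_step (h : HandshakeInv G base Seen s) (hstep : StageStep G active s s')
    {u w : V} {ℓ m : Fin Δ} (hl : G.link u ℓ = some (w, m)) (hlive : (s' u).Live ℓ)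
    (hp : (s' w).phase = (s' u).phase) (hs : (s' w).synch = true) :
    (s' u).block ℓ = (s' w).block m := by
  have hu := hstep.not_executes_of_live hlive
  obtain ⟨hw, hs⟩ := (hstep.synch_iff w).1 hs
  rw [(hstep.phase_of_not_executes hu).1, (hstep.phase_of_not_executes hw).1] at hp
  have hl' := G.symm _ _ _ _ hl
  -- A `Block` by one end is a write at the other, so both bits receive the same writes in the stage
  -- and only the old values matter.
  suffices hb : (s u).block ℓ = (s w).block m by
    rw [Bool.eq_iff_iff, hstep.block_iff, hstep.block_iff, blockedBy_iff_of_link hl,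
      blockedBy_iff_of_link hl', hb]
    tauto
  rw [hstep.live_iff] at hlive
  by_cases hsw : (s w).synch = true
  · rcases hlive with ⟨h1, -⟩ | ⟨-, h0, w', m', hl2, hv⟩
    · exact h.block_eq u ℓ w m hl h1 hp hsw
    · rw [hl] at hl2
      cases hl2
      rw [(h.idle u ℓ h0).1, h.block_of_behind w m u ℓ hl' ((not_invalid_iff hp).1 hv hsw)
        (Or.inr ⟨hp.symm, h0⟩)]
  · have hsw : (s w).synch = false := by simpa using hsw
    rw [(h.idle w m hsw).1]
    rcases hlive with ⟨h1, -⟩ | ⟨-, h0, -⟩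
    · exact h.block_of_behind u ℓ w m hl h1 (Or.inr ⟨hp, hsw⟩)
    · exact (h.idle u ℓ h0).1

theorem block_of_behind_step (h : HandshakeInv G base Seen s) (hstep : StageStep G active s s')
    {u w : V} {ℓ m : Fin Δ} (hl : G.link u ℓ = some (w, m)) (hlive : (s' u).Live ℓ)
    (hp : (s' w).phase < (s' u).phase ∨ (s' w).phase = (s' u).phase ∧ (s' w).synch = false) :
    (s' u).block ℓ = false := by
  by_contra hb
  rw [Bool.not_eq_false] at hb
  have hu := hstep.not_executes_of_live hlive
  have hpu := (hstep.phase_of_not_executes hu).1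
  by_cases h0 : (s u).block ℓ = false
  · obtain ⟨w', m', hl2, hpw, hbw, -, -, -⟩ := h.block_event hstep h0 hb
    rw [hl] at hl2
    cases hl2
    have hact : ¬ Executes active s w ∧ (s' w).synch = true := by
      rcases (hstep.block_iff u ℓ).1 hb with h2 | h2 | h2
      · simp [h0] at h2
      · obtain ⟨ha, -⟩ := h.writes hl h2
        have he : ¬ Executes active s w := by
          intro he
          have := ha.block_of_executes he
          simp [hbw] at this
        exact ⟨he, (hstep.synch_iff w).2 ⟨he, Or.inl ha.1⟩⟩
      · rw [blockedBy_iff_of_link hl] at h2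
        have he : ¬ Executes active s w := fun he => he.not_writes m h2
        exact ⟨he, (hstep.synch_iff w).2 ⟨he, Or.inr h2.1⟩⟩
    have := (hstep.phase_of_not_executes hact.1).1
    rcases hp with hp | ⟨-, hp⟩
    · omega
    · simp [hact.2] at hp
  · rw [Bool.not_eq_false] at h0
    have hs : (s u).synch = true := by
      by_contra hs
      simp [(h.idle u ℓ (by simpa using hs)).1] at h0
    rcases (hstep.live_iff u ℓ).1 hlive with ⟨h1, -⟩ | ⟨-, h2, -⟩
    · have hlew := hstep.phase_le w
      have := h.block_of_behind u ℓ w m hl h1 (by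
        by_cases hlt : (s w).phase < (s u).phase
        · exact Or.inl hlt
        · refine Or.inr ⟨by omega, ?_⟩
          have he : ¬ Executes active s w := by
            intro he
            have := (hstep.phase_of_executes he).1
            omega
          have hsw : ¬ (s' w).synch = true := by
            rcases hp with hp | ⟨-, hp⟩
            · omega
            · simp [hp]
          rw [hstep.synch_iff] at hsw
          simpa using fun hsw' => hsw ⟨he, Or.inl hsw'⟩)
      simp [h0] at this
    · simp [hs] at h2

theorem idle_step (h : HandshakeInv G base Seen s) (hstep : StageStep G active s s')
    {u : V} (hs : (s' u).synch = false) (ℓ : Fin Δ) :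
    (s' u).block ℓ = false ∧ (s' u).ack ℓ = false := by
  have hb : ¬ BlockedBy G active s u ℓ := by
    intro hb
    obtain ⟨he, hl, -⟩ := h.not_executes_of_blockedBy hb
    have := (hstep.synch_iff u).2 ⟨he, Or.inl hl.1⟩
    simp [hs] at this
  rcases hstep.node_cases u with ⟨h1, h2⟩ | ⟨h1, h2, h3⟩ | ⟨h1, r, -, h2⟩
  · rw [h2] at hs ⊢
    simpa [hb] using h.idle u ℓ hs
  · rw [h3] at hs
    simp [KState.handshake_synch] at hs
  · simp [h2, hb]

end HandshakeInv

end Preservation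

/-- The snapshot that `u` has seen at the beginning of its current phase, after the stage. -/
noncomputable def nextBase (G : Snapshot V Δ) (active : Set V) (s : V → KState A)
    (base : V → Fin Δ → Option (V × Fin Δ)) (u : V) : Fin Δ → Option (V × Fin Δ) :=
  if u ∈ active ∧ (s u).synch = false then G.link u else base u

/-! ### Stored information, and the passage to the next snapshot -/

section Preservation

variable {G : Snapshot V Δ} {active : Set V} {base : V → Fin Δ → Option (V × Fin Δ)}
  {Seen Seen' : V → ℕ → A.State → Prop} {s s' : V → KState A}

/-- Bits are set at loop ports only, where the stored information already comes from the current
phase. This later shows that `ExecuteSynch` uses information of the right phase. -/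
theorem KState.handshake_bits {s : KState A} {p : Fin Δ → Option (Pulled A)} {ℓ : Fin Δ}
    (h : (s.handshake p).block ℓ = true ∨ (s.handshake p).ack ℓ = true) :
    (s.block ℓ = true ∨ s.ack ℓ = true) ∨
      ∃ x, (s.handshake p).X ℓ = some x ∧ x.phase = s.phase := by
  have key : ℓ ∈ (s.handshakePull p).loopPorts →
      ∃ x, (s.handshake p).X ℓ = some x ∧ x.phase = s.phase := by
    intro hl
    simp only [loopPorts, Finset.mem_filter, handshakePull_phase] at hl
    exact hl.2.1
  simp only [handshake, handshakeLoop, handshakePull_block, handshakePull_ack] at h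
  by_cases hl : ℓ ∈ (s.handshakePull p).loopPorts
  · exact Or.inr (key hl)
  · have hb : ℓ ∉ (s.handshakePull p).blockPorts := fun hb => hl (Finset.mem_filter.1 hb).1
    simp [hl, hb] at h
    exact Or.inl h

theorem HandshakeInv.mem_step (h : HandshakeInv G base Seen s)
    (hstep : StageStep G active s s') (hsub : ∀ w n a, Seen w n a → Seen' w n a)
    {u : V} {ℓ : Fin Δ} (hs : (s' u).synch = true) (hP : ℓ ∈ (s' u).P) :
    ∃ x w m, (s' u).X ℓ = some x ∧
      nextBase G active s base u ℓ = some (w, m) ∧ ((s' u).Live ℓ → G.link u ℓ = some (w, m)) ∧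
      ((s' u).block ℓ = true ∨ (s' u).ack ℓ = true → x.phase = (s' u).phase) ∧
      ∃ a, Seen' w x.phase a ∧ x.algMain = a.main ∧ x.algPort = a.port m := by
  have hlive' := hstep.live_iff u ℓ
  rcases hstep.node_cases u with ⟨h1, h2⟩ | ⟨h1, h2, h3⟩ | ⟨h1, r, -, h2⟩
  · rw [h2] at hs hP
    obtain ⟨x, w, m, hx, hbase, hl, hb, a, ha, hxa⟩ := h.mem u ℓ hs hP
    refine ⟨x, w, m, by rw [h2]; exact hx, by simp [nextBase, h1, hbase], fun hlive => ?_, ?_,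
      a, hsub _ _ _ ha, hxa⟩
    · rcases hlive'.1 hlive with hlive | hlive
      · exact hl hlive.1
      · exact absurd hlive.1 h1
    · rw [h2]
      intro hba
      -- A neighbour blocks only a port whose `ack` is already 1, so the old clause already says
      -- that the stored phase is current.
      by_cases hbb : BlockedBy G active s u ℓ
      · exact hb (Or.inr (h.not_executes_of_blockedBy hbb).2.2.2)
      · exact hb (by simpa [hbb] using hba)
  · have hbits : (s' u).block ℓ = true ∨ (s' u).ack ℓ = true →
        ((s u).block ℓ = true ∨ (s u).ack ℓ = true) ∨
          ∃ x, (s' u).X ℓ = some x ∧ x.phase = (s u).phase := by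
      rw [h3]
      intro hba
      by_cases hbb : BlockedBy G active s u ℓ
      · exact Or.inl (Or.inr (h.not_executes_of_blockedBy hbb).2.2.2)
      · exact KState.handshake_bits (by simpa [hbb] using hba)
    have hphase : (s' u).phase = (s u).phase := by
      rw [h3]; exact KState.handshake_phase _ _
    have hP' : (s' u).P = ((s u).handshakePull (pullFrom G s u)).P := by rw [h3]; rfl
    have hX' : (s' u).X = ((s u).handshakePull (pullFrom G s u)).X := by rw [h3]; rfl
    rw [hphase]
    by_cases hs0 : (s u).synch = false
    · simp only [KState.handshakePull, hs0, KState.beginPhase, if_true] at hP' hX'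
      have hidle := h.idle u ℓ hs0
      rcases hl : G.link u ℓ with _ | ⟨w, m⟩
      · simp [hP', pullFrom, hl] at hP
      · have hx : (s' u).X ℓ = some ((s w).exposed m) := by
          rw [hX']; simp [pullFrom, hl]
        refine ⟨_, w, m, hx, by simp [nextBase, h1, hs0, hl], fun _ => rfl, fun hba => ?_,
          (s w).alg, hsub _ _ _ (h.seen_self w), rfl, rfl⟩
        rcases hbits hba with hba | ⟨x, hx', hxp⟩
        · simp [hidle] at hba
        · rw [hx] at hx'
          cases hx'
          exact hxp
    · have hs1 : (s u).synch = true := by simpa using hs0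
      simp only [KState.handshakePull, hs1, Bool.true_eq_false, if_false, KState.continuePhase]
        at hP' hX'
      rw [hP'] at hP
      obtain ⟨x, w, m, hx, hbase, hl, hb, a, ha, hxa⟩ := h.mem u ℓ hs1 hP
      have hbase' : nextBase G active s base u ℓ = some (w, m) := by
        simp [nextBase, hs1, hbase]
      have hl' : (s' u).Live ℓ → G.link u ℓ = some (w, m) := by
        intro hlive
        rcases hlive'.1 hlive with hlive | hlive
        · exact hl hlive.1
        · simp [hs1] at hlive
      by_cases hmem : ℓ ∈ (s u).P \ ((s u).Dt ∪ (s u).D)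
      · have hlink := hl (by
          simp only [Finset.mem_sdiff, Finset.mem_union, not_or] at hmem
          exact ⟨hs1, hmem.1, hmem.2⟩)
        have hx' : (s' u).X ℓ = if x.phase < (s u).phase then some ((s w).exposed m)
            else some { x with ack := ((s w).exposed m).ack } := by
          rw [hX']
          dsimp only
          rw [if_pos hmem, hx, pullFrom_of_link hlink, KState.refresh_some]
        by_cases hlt : x.phase < (s u).phase
        · rw [if_pos hlt] at hx'
          refine ⟨_, w, m, hx', hbase', hl', fun hba => ?_, (s w).alg,
            hsub _ _ _ (h.seen_self w), rfl, rfl⟩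
          rcases hbits hba with hba | ⟨y, hy, hyp⟩
          · exact absurd (hb hba) hlt.ne
          · rw [hx'] at hy
            cases hy
            exact hyp
        · rw [if_neg hlt] at hx'
          refine ⟨_, w, m, hx', hbase', hl', fun hba => ?_, a, hsub _ _ _ ha, hxa⟩
          rcases hbits hba with hba | ⟨y, hy, hyp⟩
          · exact hb hba
          · rw [hx'] at hy
            cases hy
            exact hyp
      · have hx' : (s' u).X ℓ = some x := by
          rw [hX']
          dsimp only
          rw [if_neg hmem, hx]
        refine ⟨_, w, m, hx', hbase', hl', fun hba => ?_, a, hsub _ _ _ ha, hxa⟩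
        rcases hbits hba with hba | ⟨y, hy, hyp⟩
        · exact hb hba
        · rw [hx'] at hy
          cases hy
          exact hyp
  · simp [h2] at hs

theorem HandshakeInv.step (h : HandshakeInv G base Seen s)
    (hstep : StageStep G active s s') (hsub : ∀ w n a, Seen w n a → Seen' w n a)
    (hself : ∀ u, Seen' u (s' u).phase (s' u).alg)
    (hle : ∀ u n a, Seen' u n a → n ≤ (s' u).phase) :
    HandshakeInv G (nextBase G active s base) Seen' s' where
  seen_self := hself
  le_of_seen := hle
  idle _ ℓ hs := h.idle_step hstep hs ℓ
  mem _ _ hs hP := h.mem_step hstep hsub hs hP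
  live_symm _ _ _ _ hl := h.live_symm_step hstep hl
  block_of_lt _ _ _ _ hl := h.block_of_lt_step hstep hl
  block_eq _ _ _ _ hl := h.block_eq_step hstep hl
  block_of_behind _ _ _ _ hl := h.block_of_behind_step hstep hl

theorem KState.Live.of_detect {disc : V → Finset (Fin Δ)} {u : V} {ℓ : Fin Δ}
    (h : (detect disc s u).Live ℓ) : (s u).Live ℓ ∧ ℓ ∉ disc u := by
  simp only [Live, detect, Finset.mem_union, not_or] at h
  exact ⟨⟨h.1, h.2.1, h.2.2.1, h.2.2.2.1⟩, h.2.2.2.2⟩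

theorem DynamicNetwork.link_succ {G : DynamicNetwork V Δ} {t : ℕ} {u : V} {ℓ : Fin Δ}
    {x : V × Fin Δ} (hl : (G t).link u ℓ = some x) (hd : ℓ ∉ G.disconnected (t + 1) u) :
    (G (t + 1)).link u ℓ = some x := by
  simpa [DynamicNetwork.disconnected, hl] using hd

/-- A port still live after detection carries the same edge in both snapshots, so the clauses
transfer from the old one. For `live_symm`, the edge persists as seen from its other end too, so
that end detects nothing either. -/
theorem HandshakeInv.detect {G : DynamicNetwork V Δ} {t : ℕ}
    (h : HandshakeInv (G t) base Seen s) :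
    HandshakeInv (G (t + 1)) base Seen (detect (G.disconnected (t + 1)) s) := by
  have key : ∀ {u ℓ w m}, (G (t + 1)).link u ℓ = some (w, m) →
      (_root_.detect (G.disconnected (t + 1)) s u).Live ℓ →
      (G t).link u ℓ = some (w, m) ∧ (s u).Live ℓ := by
    intro u ℓ w m hl hlive
    obtain ⟨hlive, hd⟩ := hlive.of_detect
    obtain ⟨x, w', m', -, -, hl', -⟩ := h.mem u ℓ hlive.1 hlive.2.1
    have hl' := hl' hlive
    have := DynamicNetwork.link_succ hl' hd
    rw [hl] at this
    cases this
    exact ⟨hl', hlive⟩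
  constructor
  · exact h.seen_self
  · exact h.le_of_seen
  · exact h.idle
  · intro u ℓ hs hP
    obtain ⟨x, w, m, hx, hb, hl, hrest⟩ := h.mem u ℓ hs hP
    refine ⟨x, w, m, hx, hb, fun hlive => ?_, hrest⟩
    obtain ⟨hlive, hd⟩ := hlive.of_detect
    exact DynamicNetwork.link_succ (hl hlive) hd
  · intro u ℓ w m hl hlive hp hs
    obtain ⟨hl0, hlive⟩ := key hl hlive
    have := h.live_symm u ℓ w m hl0 hlive hp hs
    refine ⟨this.1, this.2.1, this.2.2.1, ?_⟩
    have h1 := (G t).symm _ _ _ _ hl0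
    have h2 := (G (t + 1)).symm _ _ _ _ hl
    have hd : m ∉ G.disconnected (t + 1) w := by
      simp [DynamicNetwork.disconnected, h1, h2]
    simp only [_root_.detect, Finset.mem_union, not_or]
    exact ⟨this.2.2.2, hd⟩
  · intro u ℓ w m hl hlive
    obtain ⟨hl0, hlive⟩ := key hl hlive
    exact h.block_of_lt u ℓ w m hl0 hlive
  · intro u ℓ w m hl hlive
    obtain ⟨hl0, hlive⟩ := key hl hlive
    exact h.block_eq u ℓ w m hl0 hlive
  · intro u ℓ w m hl hlive
    obtain ⟨hl0, hlive⟩ := key hl hlive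
    exact h.block_of_behind u ℓ w m hl0 hlive

end Preservation

/-! ## Semi-synchronous executions -/

theorem StageStep.persist {G : Snapshot V Δ} {active : Set V} {s s' : V → KState A}
    (h : StageStep G active s s') {u : V} (hs : (s u).synch = true)
    (hu : ¬ Executes active s u) :
    (s' u).P = (s u).P ∧ (s u).Dt ⊆ (s' u).Dt ∧
      (∀ ℓ, (s u).block ℓ = true → (s' u).block ℓ = true) ∧
      (∀ ℓ, (s u).ack ℓ = true → (s' u).ack ℓ = true) := by
  refine ⟨?_, ?_, fun ℓ hb => (h.block_iff u ℓ).2 (Or.inl ⟨hb, hu⟩), ?_⟩ <;>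
  rcases h.node_cases u with ⟨h1, h2⟩ | ⟨h1, h2, h3⟩ | ⟨h1, r, -, h2⟩
  · rw [h2]
  · simp [h3, KState.handshake, KState.handshakeLoop, KState.handshakePull, hs,
      KState.continuePhase]
  · exact absurd h1 hu
  · rw [h2]
  · simp [h3, KState.handshake, KState.handshakeLoop, KState.handshakePull, hs,
      KState.continuePhase]
  · exact absurd h1 hu
  · intro ℓ hℓ
    rw [h2]
    exact hℓ
  · intro ℓ hℓ
    simp only [h3, KState.handshake, KState.handshakeLoop, KState.handshakePull_ack]
    split_ifs <;> simp [hℓ]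
  · exact absurd h1 hu

/-- The configuration in which the nodes act in stage `t`. -/
noncomputable def stageConfig (G : DynamicNetwork V Δ) (c : ℕ → V → KState A) (t : ℕ) :
    V → KState A :=
  detect (G.disconnected t) (c t)

/-- The snapshots seen by the nodes at the beginning of their phases, in stage `t`. -/
noncomputable def baseAt (G : DynamicNetwork V Δ) (active : ℕ → Set V) (c : ℕ → V → KState A) :
    ℕ → V → Fin Δ → Option (V × Fin Δ)
  | 0 => fun _ _ => none
  | t + 1 => nextBase (G t) (active t) (stageConfig G c t) (baseAt G active c t)

/-- Up to stage `t` node `w` has been in phase `n` with `A`-state `a`. -/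
def SeenAt (c : ℕ → V → KState A) (t : ℕ) (w : V) (n : ℕ) (a : A.State) : Prop :=
  ∃ t' ≤ t, (c t' w).phase = n ∧ (c t' w).alg = a

namespace IsSemiExecution

variable {Init : Set (V → A.State)} {G : DynamicNetwork V Δ} {active : ℕ → Set V}
  {c : ℕ → V → KState A}

theorem stage (hc : IsSemiExecution Init G active c) (t : ℕ) :
    StageStep (G t) (active t) (stageConfig G c t) (c (t + 1)) := hc.2.2 t

theorem phase_succ (hc : IsSemiExecution Init G active c) (t : ℕ) (u : V) :
    (c t u).phase ≤ (c (t + 1) u).phase ∧ (c (t + 1) u).phase ≤ (c t u).phase + 1 :=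
  (hc.stage t).phase_le u

theorem phase_mono (hc : IsSemiExecution Init G active c) (u : V) :
    Monotone fun t => (c t u).phase :=
  monotone_nat_of_le_succ fun t => (hc.phase_succ t u).1

theorem executes_iff (hc : IsSemiExecution Init G active c) (t : ℕ) (u : V) :
    Executes (active t) (stageConfig G c t) u ↔ (c (t + 1) u).phase = (c t u).phase + 1 := by
  constructor
  · exact fun h => ((hc.stage t).phase_of_executes h).1
  · intro h
    by_contra hn
    have : (c (t + 1) u).phase = (c t u).phase := ((hc.stage t).phase_of_not_executes hn).1
    omega

theorem not_executes_iff (hc : IsSemiExecution Init G active c) (t : ℕ) (u : V) :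
    ¬ Executes (active t) (stageConfig G c t) u ↔ (c (t + 1) u).phase = (c t u).phase := by
  rw [hc.executes_iff]
  have := hc.phase_succ t u
  omega

theorem alg_eq (hc : IsSemiExecution Init G active c) {u : V} {t t' : ℕ} (h : t ≤ t')
    (hp : (c t' u).phase = (c t u).phase) : (c t' u).alg = (c t u).alg := by
  induction t', h using Nat.le_induction with
  | base => rfl
  | succ k hk ih =>
    have h1 : (c t u).phase ≤ (c k u).phase := hc.phase_mono u hk
    have h2 := hc.phase_succ k u
    have h3 := ((hc.stage k).phase_of_not_executes ((hc.not_executes_iff k u).2 (by omega))).2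
    rw [h3]
    exact ih (by omega)

theorem alg_eq_of_phase_eq (hc : IsSemiExecution Init G active c) {u : V} {t t' : ℕ}
    (hp : (c t' u).phase = (c t u).phase) : (c t' u).alg = (c t u).alg := by
  rcases le_total t t' with h | h
  · exact hc.alg_eq h hp
  · exact (hc.alg_eq h hp.symm).symm

/-- What does not change in the course of a phase, once it has begun. -/
theorem persist (hc : IsSemiExecution Init G active c) {u : V} {t t' : ℕ} (h : t ≤ t')
    (hp : (c t' u).phase = (c t u).phase) (hs : (c t u).synch = true) :
    (c t' u).synch = true ∧ (c t' u).P = (c t u).P ∧ (c t u).Dt ⊆ (c t' u).Dt ∧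
      (∀ ℓ, (c t u).block ℓ = true → (c t' u).block ℓ = true) ∧
      (∀ ℓ, (c t u).ack ℓ = true → (c t' u).ack ℓ = true) ∧
      baseAt G active c t' u = baseAt G active c t u := by
  induction t', h using Nat.le_induction with
  | base => exact ⟨hs, rfl, subset_rfl, fun _ => id, fun _ => id, rfl⟩
  | succ k hk ih =>
    have h1 : (c t u).phase ≤ (c k u).phase := hc.phase_mono u hk
    have h2 := hc.phase_succ k u
    have hne := (hc.not_executes_iff k u).2 (by omega)
    obtain ⟨i1, i2, i3, i4, i5, i6⟩ := ih (by omega)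
    have i1' : (stageConfig G c k u).synch = true := i1
    obtain ⟨j1, j2, j3, j4⟩ := (hc.stage k).persist i1' hne
    refine ⟨((hc.stage k).synch_iff u).2 ⟨hne, Or.inl i1'⟩, j1.trans i2, i3.trans j2,
      fun ℓ hℓ => j3 ℓ (i4 ℓ hℓ), fun ℓ hℓ => j4 ℓ (i5 ℓ hℓ), ?_⟩
    rw [← i6]
    simp [baseAt, nextBase, i1']

theorem inv_post_of_inv (hc : IsSemiExecution Init G active c) {t : ℕ}
    (h : HandshakeInv (G t) (baseAt G active c t) (SeenAt c t) (stageConfig G c t)) :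
    HandshakeInv (G t) (baseAt G active c (t + 1)) (SeenAt c (t + 1)) (c (t + 1)) := by
  refine h.step (hc.stage t) ?_ (fun u => ⟨t + 1, le_rfl, rfl, rfl⟩) ?_
  · rintro w n a ⟨t', ht, h⟩
    exact ⟨t', by omega, h⟩
  · rintro w n a ⟨t', ht, rfl, -⟩
    exact hc.phase_mono w ht

theorem inv (hc : IsSemiExecution Init G active c) (t : ℕ) :
    HandshakeInv (G t) (baseAt G active c t) (SeenAt c t) (stageConfig G c t) := by
  induction t with
  | zero =>
    obtain ⟨c₀, -, h0⟩ := hc.1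
    have hs : ∀ u, stageConfig G c 0 u = KState.init (c₀ u) := by
      intro u
      simp [stageConfig, detect, DynamicNetwork.disconnected, h0, KState.init]
    constructor <;> simp only [hs, KState.Live, KState.init] <;> try simp
    · intro u
      exact ⟨0, le_rfl, by simp [h0, KState.init]⟩
    · rintro u n a ⟨t', ht, h, -⟩
      obtain rfl : t' = 0 := by omega
      simpa [h0, KState.init] using h.symm
  | succ t ih => exact (hc.inv_post_of_inv ih).detect

theorem inv_post (hc : IsSemiExecution Init G active c) (t : ℕ) :
    HandshakeInv (G t) (baseAt G active c (t + 1)) (SeenAt c (t + 1)) (c (t + 1)) :=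
  hc.inv_post_of_inv (hc.inv t)

/-- The emulated network combines edges seen in different stages, but all ports of one node are
recorded from a single snapshot, so simplicity is inherited. -/
theorem baseAt_simple (t : ℕ) (u w : V) (ℓ ℓ' m m' : Fin Δ)
    (h : baseAt G active c t u ℓ = some (w, m)) (h' : baseAt G active c t u ℓ' = some (w, m')) :
    ℓ = ℓ' := by
  induction t with
  | zero => simp [baseAt] at h
  | succ t ih =>
    simp only [baseAt, nextBase] at h h'
    split_ifs at h h'
    · exact (G t).simple _ _ _ _ _ _ h h'
    · exact ih h h'

theorem exists_block_event (hc : IsSemiExecution Init G active c) {t : ℕ} {u : V} {ℓ : Fin Δ}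
    (h : (c t u).block ℓ = true) : ∃ t', (c t' u).phase = (c t u).phase ∧
      (c t' u).block ℓ = false ∧ (c (t' + 1) u).block ℓ = true := by
  induction t with
  | zero =>
    obtain ⟨c₀, -, h0⟩ := hc.1
    simp [h0, KState.init] at h
  | succ t ih =>
    by_cases hb : (c t u).block ℓ = true
    · obtain ⟨t', ht', h'⟩ := ih hb
      refine ⟨t', ?_, h'⟩
      -- The phase cannot have changed in between, since a node that ends a phase starts the next
      -- one with all bits 0.
      rw [ht', eq_comm, ← hc.not_executes_iff]
      intro he
      have := (hc.inv_post t).idle u ℓ ((hc.stage t).phase_of_executes he).2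
      simp [h] at this
    · have hb : (c t u).block ℓ = false := by simpa using hb
      obtain ⟨w, m, -, -, -, -, hp, -⟩ := (hc.inv t).block_event (hc.stage t) hb h
      exact ⟨t, hp.symm, hb, h⟩

/-- A block bit set in some phase is still set at the end of this phase, and belongs to the same
edge. -/
theorem finalPorts_of_event (hc : IsSemiExecution Init G active c) {t T i : ℕ} {u w : V}
    {ℓ m : Fin Δ} (hT : EndsPhase c u i T) (hp : (c t u).phase = i)
    (h0 : (c t u).block ℓ = false) (h1 : (c (t + 1) u).block ℓ = true)
    (hl : (G t).link u ℓ = some (w, m)) :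
    ℓ ∈ (c T u).finalPorts ∧ baseAt G active c T u ℓ = some (w, m) := by
  obtain ⟨-, -, -, -, -, -, hp', hlive⟩ := (hc.inv t).block_event (hc.stage t) h0 h1
  have hp' : (c (t + 1) u).phase = (c t u).phase := hp'
  have hle : t + 1 ≤ T := by
    by_contra hlt
    have : (c (T + 1) u).phase ≤ (c (t + 1) u).phase := hc.phase_mono u (by omega)
    have := hT.2
    omega
  obtain ⟨-, hP, -, hb, -, hbase⟩ := hc.persist hle (by rw [hT.1, hp', hp]) hlive.1
  obtain ⟨x, w', m', -, hb', hl', -⟩ := (hc.inv_post t).mem u ℓ hlive.1 hlive.2.1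
  have hl' := hl' hlive
  rw [hl] at hl'
  cases hl'
  rw [hbase]
  refine ⟨?_, hb'⟩
  simp only [KState.finalPorts, Finset.mem_filter]
  exact ⟨hP ▸ hlive.2.1, hb ℓ h1⟩

theorem _root_.EndsPhase.executes (hc : IsSemiExecution Init G active c) {u : V} {i T : ℕ}
    (hT : EndsPhase c u i T) : Executes (active T) (stageConfig G c T) u :=
  (hc.executes_iff T u).2 (by rw [hT.1, hT.2])

/-- Go back to the stage in which the bit of `u` was set: the bit at the other end was set in that
same stage and phase, and it too persists to the end of the phase of `w`. -/
theorem final_symm (hc : IsSemiExecution Init G active c) {i T T' : ℕ} {u w : V} {ℓ m : Fin Δ}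
    (hT : EndsPhase c u i T) (hT' : EndsPhase c w i T') (hℓ : ℓ ∈ (c T u).finalPorts)
    (hb : baseAt G active c T u ℓ = some (w, m)) :
    (m ∈ (c T' w).finalPorts ∧ baseAt G active c T' w m = some (u, ℓ)) ∧ w ≠ u := by
  obtain ⟨t, hp, h0, h1⟩ := hc.exists_block_event (Finset.mem_filter.1 hℓ).2
  obtain ⟨w', m', hl, hpw, h0w, h1w, -⟩ := (hc.inv t).block_event (hc.stage t) h0 h1
  have hp : (c t u).phase = i := hp.trans hT.1
  have hb' := (hc.finalPorts_of_event hT hp h0 h1 hl).2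
  rw [hb] at hb'
  cases hb'
  refine ⟨hc.finalPorts_of_event hT' (Eq.trans hpw hp) h0w h1w ((G t).symm _ _ _ _ hl), ?_⟩
  rintro rfl
  exact (G t).loopless _ _ _ hl

/-- The network of the emulated synchronous execution, if node `u` ends phase `i` in stage
`T i u`. -/
noncomputable def emulatedNetwork (hc : IsSemiExecution Init G active c) (T : ℕ → V → ℕ)
    (hT : ∀ i u, EndsPhase c u i (T i u)) : DynamicNetwork V Δ := fun i =>
  { link := fun u ℓ =>
      if ℓ ∈ (c (T i u) u).finalPorts then baseAt G active c (T i u) u ℓ else none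
    symm := by
      intro u ℓ w m h
      split_ifs at h with hℓ
      obtain ⟨⟨h1, h2⟩, -⟩ := hc.final_symm (hT i u) (hT i w) hℓ h
      rw [if_pos h1, h2]
    loopless := by
      intro u ℓ m h
      split_ifs at h with hℓ
      exact (hc.final_symm (hT i u) (hT i u) hℓ h).2 rfl
    simple := by
      intro u w ℓ ℓ' m m' h h'
      split_ifs at h h'
      exact baseAt_simple _ _ _ _ _ _ _ h h' }

theorem phase_zero (hc : IsSemiExecution Init G active c) (u : V) : (c 0 u).phase = 0 := by
  obtain ⟨c₀, -, h0⟩ := hc.1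
  simp [h0, KState.init]

theorem alg_succ_of_endsPhase (hc : IsSemiExecution Init G active c) {T : ℕ → V → ℕ}
    (hT : ∀ i u, EndsPhase c u i (T i u)) (i : ℕ) (u : V) :
    (c (T i u + 1) u).alg = (c (T (i + 1) u) u).alg :=
  hc.alg_eq_of_phase_eq (by rw [(hT i u).2, (hT (i + 1) u).1])

theorem emulates (hc : IsSemiExecution Init G active c) (T : ℕ → V → ℕ)
    (hT : ∀ i u, EndsPhase c u i (T i u)) :
    A.IsSyncExecution Init (hc.emulatedNetwork T hT) (fun i u => (c (T i u) u).alg) ∧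
      SameOutcome c (fun i u => (c (T i u) u).alg) := by
  have h0 : ∀ u, (c (T 0 u) u).alg = (c 0 u).alg := fun u =>
    hc.alg_eq_of_phase_eq (by rw [(hT 0 u).1, hc.phase_zero])
  refine ⟨⟨?_, ?_⟩, fun u => (h0 u).symm, fun i u => ⟨⟨_, hT i u⟩, fun t ht => ?_⟩⟩
  · obtain ⟨c₀, hi, hc0⟩ := hc.1
    have : (fun u => (c (T 0 u) u).alg) = c₀ := by
      funext u
      simp [h0, hc0, KState.init]
    simpa only [this] using hi
  · intro i u
    dsimp only
    rw [← hc.alg_succ_of_endsPhase hT]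
    have hexec := (hT i u).executes hc
    rcases (hc.stage (T i u)).node_cases u with ⟨h1, h2⟩ | ⟨h1, h2, h3⟩ | ⟨h1, r, hr, h2⟩
    · exact absurd hexec.1 h1
    · exact absurd h2 (KState.not_handshakeGuard_of_executeGuard hexec.2)
    rw [h2]
    suffices hv : A.view (hc.emulatedNetwork T hT i) (fun u => (c (T i u) u).alg) u =
        (stageConfig G c (T i u) u).emulatedView by
      rw [hv]
      exact hr
    funext ℓ
    have hF : (stageConfig G c (T i u) u).finalPorts = (c (T i u) u).finalPorts := rfl
    simp only [PullAlgorithm.view, emulatedNetwork, KState.emulatedView, hF]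
    by_cases hℓ : ℓ ∈ (c (T i u) u).finalPorts
    · have hℓ' := Finset.mem_filter.1 hℓ
      obtain ⟨x, w, m, hx, hb, -, hbl, a, ⟨t', -, hp', ha⟩, hm, hpt⟩ :=
        (hc.inv (T i u)).mem u ℓ h1.2.1 hℓ'.1
      have hxp : x.phase = i := (hbl (Or.inl hℓ'.2)).trans (hT i u).1
      -- The information may have been pulled long before `w` ends phase `i`, but an `A`-state is
      -- constant throughout a phase.
      have : (c (T i w) w).alg = a := by
        rw [← ha]
        exact hc.alg_eq_of_phase_eq (by rw [(hT i w).1, hp', hxp])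
      rw [if_pos hℓ, if_pos hℓ, hb, hx]
      simp [this, hm, hpt]
    · rw [if_neg hℓ, if_neg hℓ]
      rfl
  · dsimp only
    exact hc.alg_eq_of_phase_eq (by rw [ht.2, (hT (i + 1) u).1])

end IsSemiExecution

/-! ## Progress -/

/-- An activated node with a neighbour in the same phase acknowledges it, or executes `Block` if
the neighbour has acknowledged already. -/
theorem HandshakeInv.ack_or_block {G : Snapshot V Δ} {active : Set V}
    {base : V → Fin Δ → Option (V × Fin Δ)} {Seen : V → ℕ → A.State → Prop}
    {s s' : V → KState A} (h : HandshakeInv G base Seen s) (hstep : StageStep G active s s')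
    {u w : V} {ℓ m : Fin Δ} (hact : u ∈ active) (hlive : (s u).Live ℓ)
    (hl : G.link u ℓ = some (w, m)) (hp : (s w).phase = (s u).phase)
    (hb : (s u).block ℓ = false) :
    ((s w).ack m = true → (s' u).block ℓ = true) ∧
      ((s w).ack m = false → (s' u).ack ℓ = true) := by
  rcases hstep.node_cases u with ⟨h1, -⟩ | ⟨h1, h2, h3⟩ | ⟨h1, -⟩
  · exact absurd hact h1
  · have hloop : ℓ ∈ ((s u).handshakePull (pullFrom G s u)).loopPorts := by
      obtain ⟨x, w', m', hx, -, hl', -, a, ha, -⟩ := h.mem u ℓ hlive.1 hlive.2.1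
      have hl' := hl' hlive
      rw [hl] at hl'
      cases hl'
      have hle := h.le_of_seen _ _ _ ha
      simp only [KState.loopPorts, Finset.mem_filter, KState.handshakePull_block,
        KState.handshakePull_phase]
      simp only [KState.handshakePull, hlive.1, Bool.true_eq_false, if_false,
        KState.continuePhase]
      have hmem : ℓ ∈ (s u).P \ ((s u).Dt ∪ (s u).D) := by
        simpa using hlive.2
      refine ⟨hmem, ?_, hb⟩
      rw [if_pos hmem, hx, pullFrom_of_link hl, KState.refresh_some]
      split_ifs with hlt
      · exact ⟨_, rfl, hp⟩
      · exact ⟨_, rfl, by simp only; omega⟩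
    obtain ⟨-, w', m', x, hl', hx, -, -, hxa, -⟩ := h.loopPorts_cases hloop
    rw [hl] at hl'
    cases hl'
    simp only [h3, KState.handshake, KState.handshakeLoop, KState.blockPorts]
    constructor
    · intro ha
      simp [hloop, hx, hxa, ha]
    · intro ha
      simp [hloop, hx, hxa, ha]
  · have := hlive.block_of_executes h1
    simp [hb] at this

theorem WeaklyFair.exists_active {active : ℕ → Set V} {c : ℕ → V → KState A}
    (hf : WeaklyFair active c) (u : V) (t : ℕ) : ∃ t' ≥ t, u ∈ active t' :=
  hf u t fun _ _ => KState.enabled _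

namespace IsSemiExecution

variable {Init : Set (V → A.State)} {G : DynamicNetwork V Δ} {active : ℕ → Set V}
  {c : ℕ → V → KState A}

theorem not_executes_of_stuck (hc : IsSemiExecution Init G active c) {u : V} {i t₀ : ℕ}
    (hu : ∀ t ≥ t₀, (c t u).phase = i) {t : ℕ} (ht : t₀ ≤ t) :
    ¬ Executes (active t) (stageConfig G c t) u :=
  (hc.not_executes_iff t u).2 (by rw [hu t ht, hu (t + 1) (by omega)])

theorem synch_of_stuck (hc : IsSemiExecution Init G active c) (hf : WeaklyFair active c) {u : V}
    {i t₀ : ℕ} (hu : ∀ t ≥ t₀, (c t u).phase = i) :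
    ∃ t₁ ≥ t₀, ∀ t ≥ t₁, (c t u).synch = true := by
  obtain ⟨t', ht', hact⟩ := hf.exists_active u t₀
  refine ⟨t' + 1, by omega, fun t ht => ?_⟩
  have h1 : (c (t' + 1) u).synch = true :=
    ((hc.stage t').synch_iff u).2 ⟨hc.not_executes_of_stuck hu ht', Or.inr hact⟩
  exact (hc.persist ht (by rw [hu t (by omega), hu (t' + 1) (by omega)]) h1).1

theorem exists_waiting_port (hc : IsSemiExecution Init G active c) (hf : WeaklyFair active c)
    {u : V} {i t₀ : ℕ} (hu : ∀ t ≥ t₀, (c t u).phase = i)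
    (hs : ∀ t ≥ t₀, (c t u).synch = true) :
    ∃ ℓ ∈ (c t₀ u).P, ∀ t ≥ t₀, ℓ ∉ (c t u).Dt ∧ (c t u).block ℓ = false := by
  by_contra hcon
  push Not at hcon
  have : ∀ ℓ, ∃ t ≥ t₀, ℓ ∈ (c t₀ u).P → ℓ ∉ (c t u).Dt → (c t u).block ℓ = true := by
    intro ℓ
    by_cases hℓ : ℓ ∈ (c t₀ u).P
    · obtain ⟨t, ht, h⟩ := hcon ℓ hℓ
      exact ⟨t, ht, fun _ => by simpa using h⟩
    · exact ⟨t₀, le_rfl, fun h => absurd h hℓ⟩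
  choose τ hτ hτ' using this
  -- Within a phase `Dt` and the block bits only grow. Past all the `τ ℓ` every port of `P` is
  -- therefore settled, and the activated node would run `ExecuteSynch`.
  obtain ⟨t, ht, hact⟩ := hf.exists_active u (t₀ + Finset.univ.sup τ)
  refine hc.not_executes_of_stuck hu (t := t) (by omega) ⟨hact, hs t (by omega), ?_⟩
  intro ℓ hℓ
  have hℓ : ℓ ∈ (c t u).P ∧ ℓ ∉ (c t u).Dt := Finset.mem_sdiff.1 hℓ
  have hle : τ ℓ ≤ t := by
    have := Finset.le_sup (f := τ) (Finset.mem_univ ℓ)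
    omega
  obtain ⟨-, hP, hDt, hb, -⟩ := hc.persist hle (by rw [hu t (by omega), hu _ (hτ ℓ)])
    (hs _ (hτ ℓ))
  have hP₀ := (hc.persist (hτ ℓ) (by rw [hu _ (hτ ℓ), hu _ le_rfl]) (hs _ le_rfl)).2.1
  exact hb ℓ (hτ' ℓ (hP₀ ▸ hP ▸ hℓ.1) fun h => hℓ.2 (hDt h))

/-- A disconnection detected by a waiting node is eventually recorded in `Dt`. -/
theorem exists_mem_Dt (hc : IsSemiExecution Init G active c) (hf : WeaklyFair active c)
    {u : V} {i t₀ : ℕ} (hu : ∀ t ≥ t₀, (c t u).phase = i)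
    (hs : ∀ t ≥ t₀, (c t u).synch = true) {t : ℕ} (ht : t₀ ≤ t) {ℓ : Fin Δ}
    (hℓ : ℓ ∈ (stageConfig G c t u).D) : ∃ k ≥ t₀, ℓ ∈ (c k u).Dt := by
  obtain ⟨t', htt', hact⟩ := hf.exists_active u t
  obtain ⟨n, rfl⟩ := Nat.exists_eq_add_of_le htt'
  induction n generalizing t with
  | zero =>
    refine ⟨t + 1, by omega, ?_⟩
    rcases (hc.stage t).node_cases u with ⟨h1, -⟩ | ⟨h1, h2, h3⟩ | ⟨h1, -⟩
    · exact absurd hact h1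
    · have hs' : (stageConfig G c t u).synch = true := hs t ht
      simp [h3, KState.handshake, KState.handshakeLoop, KState.handshakePull, hs',
        KState.continuePhase, hℓ]
    · exact absurd h1 (hc.not_executes_of_stuck hu ht)
  | succ n ih =>
    rcases (hc.stage t).node_cases u with ⟨h1, h2⟩ | ⟨h1, h2, h3⟩ | ⟨h1, -⟩
    · refine ih (t := t + 1) (by omega) ?_ (by omega) (by rwa [Nat.add_right_comm])
      simp only [stageConfig, detect, h2] at hℓ ⊢
      exact Finset.mem_union_left _ hℓ
    · refine ⟨t + 1, by omega, ?_⟩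
      have hs' : (stageConfig G c t u).synch = true := hs t ht
      simp [h3, KState.handshake, KState.handshakeLoop, KState.handshakePull, hs',
        KState.continuePhase, hℓ]
    · exact absurd h1 (hc.not_executes_of_stuck hu ht)

/-- The induction is over the phase, for all nodes together: the neighbour that a stuck node waits
for must itself be known to reach phase `i`. -/
theorem exists_le_phase (hc : IsSemiExecution Init G active c) (hf : WeaklyFair active c)
    (i : ℕ) : ∀ u, ∃ t, i ≤ (c t u).phase := by
  induction i with
  | zero => exact fun u => ⟨0, Nat.zero_le _⟩
  | succ i ih =>
    have stuck : ∀ u t₁, (∀ t ≥ t₁, (c t u).phase ≤ i) →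
        ∃ t₀ ≥ t₁, (∀ t ≥ t₀, (c t u).phase = i) ∧ ∀ t ≥ t₀, (c t u).synch = true := by
      intro u t₁ hle
      obtain ⟨t₂, ht₂⟩ := ih u
      have hu : ∀ t ≥ max t₁ t₂, (c t u).phase = i := fun t ht =>
        le_antisymm (hle t (le_trans (le_max_left _ _) ht))
          (ht₂.trans (hc.phase_mono u (le_trans (le_max_right _ _) ht)))
      obtain ⟨t₀, ht₀, hs⟩ := hc.synch_of_stuck hf hu
      exact ⟨t₀, le_trans (le_max_left _ _) ht₀, fun t ht => hu t (ht₀.trans ht), hs⟩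
    by_contra hcon
    push Not at hcon
    obtain ⟨u, hu⟩ := hcon
    obtain ⟨t₀, -, hu, hs⟩ := stuck u 0 fun t _ => Nat.lt_succ_iff.1 (hu t)
    obtain ⟨ℓ, hℓ, hwait⟩ := hc.exists_waiting_port hf hu hs
    have hpers := fun t (ht : t ≥ t₀) =>
      hc.persist ht (by rw [hu t ht, hu t₀ le_rfl]) (hs t₀ le_rfl)
    have hlive : ∀ t ≥ t₀, (stageConfig G c t u).Live ℓ := by
      intro t ht
      refine ⟨hs t ht, (hpers t ht).2.1 ▸ hℓ, (hwait t ht).1, fun hD => ?_⟩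
      obtain ⟨k, hk, hk'⟩ := hc.exists_mem_Dt hf hu hs ht hD
      exact (hwait k hk).1 hk'
    obtain ⟨-, w, m, -, hbase, -⟩ := (hc.inv t₀).mem u ℓ (hs t₀ le_rfl) hℓ
    have hlink : ∀ t ≥ t₀, (G t).link u ℓ = some (w, m) := by
      intro t ht
      obtain ⟨-, w', m', -, hb, hl, -⟩ := (hc.inv t).mem u ℓ (hlive t ht).1 (hlive t ht).2.1
      rw [(hpers t ht).2.2.2.2.2, hbase] at hb
      cases hb
      exact hl (hlive t ht)
    -- If `w` got ahead, the bit of `u` at `ℓ` would be 1; so `w` never passes phase `i`.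
    obtain ⟨t₁, ht₁, hw, hsw⟩ := stuck w t₀ (by
      intro t ht
      by_contra hlt
      have := (hc.inv t).block_of_lt u ℓ w m (hlink t ht) (hlive t ht)
        (show (c t u).phase < (c t w).phase by rw [hu t ht]; omega)
      have hb : (stageConfig G c t u).block ℓ = false := (hwait t ht).2
      simp [hb] at this)
    have hp : ∀ t ≥ t₁, (stageConfig G c t w).phase = (stageConfig G c t u).phase := fun t ht =>
      (hw t ht).trans (hu t (ht₁.trans ht)).symm
    have hlivew : ∀ t ≥ t₁, (stageConfig G c t w).Live m := fun t ht =>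
      (hc.inv t).live_symm u ℓ w m (hlink t (ht₁.trans ht)) (hlive t (ht₁.trans ht)) (hp t ht)
        (hsw t ht)
    have hblockw : ∀ t ≥ t₁, (c t w).block m = false := fun t ht =>
      ((hc.inv t).block_eq u ℓ w m (hlink t (ht₁.trans ht)) (hlive t (ht₁.trans ht)) (hp t ht)
        (hsw t ht)).symm.trans (hwait t (ht₁.trans ht)).2
    obtain ⟨t₂, ht₂, hact⟩ := hf.exists_active u t₁
    -- The `ack` that `u` writes in stage `t₂` is readable only from stage `t₂ + 1` on; at `t₃` it
    -- makes `w` execute `Block`.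
    obtain ⟨t₃, ht₃, hactw⟩ := hf.exists_active w (t₂ + 1)
    have hu₂ := (hc.inv t₂).ack_or_block (hc.stage t₂) hact (hlive t₂ (by omega))
      (hlink t₂ (by omega)) (hp t₂ (by omega)) (hwait t₂ (by omega)).2
    rw [(hwait (t₂ + 1) (by omega)).2] at hu₂
    have hack : (c (t₂ + 1) u).ack ℓ = true := hu₂.2 (by simpa using hu₂.1)
    have hack' : (c t₃ u).ack ℓ = true :=
      (hc.persist ht₃ (by rw [hu t₃ (by omega), hu (t₂ + 1) (by omega)])
        (hs _ (by omega))).2.2.2.2.1 ℓ hack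
    have := ((hc.inv t₃).ack_or_block (hc.stage t₃) hactw (hlivew t₃ (by omega))
      ((G t₃).symm _ _ _ _ (hlink t₃ (by omega))) (hp t₃ (by omega)).symm
      (hblockw t₃ (by omega))).1 hack'
    simp [hblockw (t₃ + 1) (by omega)] at this

theorem exists_endsPhase (hc : IsSemiExecution Init G active c) (hf : WeaklyFair active c)
    (i : ℕ) (u : V) : ∃ t, EndsPhase c u i t := by
  have hex := hc.exists_le_phase hf (i + 1) u
  have h1 := Nat.find_spec hex
  have h0 := hc.phase_zero u
  obtain ⟨t, ht⟩ : ∃ t, Nat.find hex = t + 1 := by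
    refine Nat.exists_eq_succ_of_ne_zero fun h => ?_
    rw [h, h0] at h1
    omega
  have h2 := Nat.find_min hex (m := t) (by omega)
  have h3 := hc.phase_succ t u
  rw [ht] at h1
  exact ⟨t, by omega, by omega⟩

end IsSemiExecution

/-- Every weakly fair semi-synchronous execution agrees with a synchronous execution. -/
theorem IsSemiExecution.exists_syncExecution {Init : Set (V → A.State)} {G : DynamicNetwork V Δ}
    {active : ℕ → Set V} {c : ℕ → V → KState A} (hc : IsSemiExecution Init G active c)
    (hf : WeaklyFair active c) :
    ∃ (H : DynamicNetwork V Δ) (d : ℕ → V → A.State),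
      A.IsSyncExecution Init H d ∧ SameOutcome c d := by
  choose T hT using hc.exists_endsPhase hf
  exact ⟨_, _, hc.emulates T hT⟩

/-! ## Synchronous executions as semi-synchronous executions -/

/-- A stage in which the nodes that run `ExecuteSynch` choose the new `A`-states `next`. -/
noncomputable def stageWith (G : Snapshot V Δ) (active : Set V) (next : V → A.State)
    (s : V → KState A) : V → KState A := fun u =>
  let r : KState A :=
    if u ∈ active then
      { (if (s u).HandshakeGuard then (s u).handshake (pullFrom G s u) else
          { s u with
            F := (s u).finalPorts
            alg := next u
            phase := (s u).phase + 1
            synch := false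
            ack := fun _ => false
            block := fun _ => false }) with D := ∅ }
    else s u
  { r with block := fun ℓ => r.block ℓ || decide (BlockedBy G active s u ℓ) }

theorem stageStep_stageWith {G : Snapshot V Δ} {active : Set V} {next : V → A.State}
    {s : V → KState A} (h : ∀ u ∈ active, (s u).ExecuteGuard →
      A.LocalStep (s u).alg (s u).emulatedView (next u)) :
    StageStep G active s (stageWith G active next s) := by
  refine fun u => ⟨_, ?_, rfl⟩
  by_cases hu : u ∈ active
  · rw [if_pos hu]
    refine Or.inr ⟨hu, _, ?_, rfl⟩
    by_cases hg : (s u).HandshakeGuard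
    · rw [if_pos hg]
      exact Or.inl ⟨hg, rfl⟩
    · rw [if_neg hg]
      have he := (s u).enabled.resolve_left hg
      exact Or.inr ⟨he, next u, h u hu he, rfl⟩
  · rw [if_neg hu]
    exact Or.inl ⟨hu, rfl⟩

/-- All nodes are about to begin phase `i`, with the `A`-states `a`. -/
def PhaseStart (i : ℕ) (a : V → A.State) (s : V → KState A) : Prop :=
  ∀ u, (s u).phase = i ∧ (s u).synch = false ∧ (s u).alg = a u ∧
    ∀ ℓ, (s u).block ℓ = false ∧ (s u).ack ℓ = false

/-- All nodes have pulled from all their neighbours in `G` in the current phase. -/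
structure PhasePulled (G : Snapshot V Δ) (i : ℕ) (a : V → A.State) (s : V → KState A) :
    Prop where
  phase : ∀ u, (s u).phase = i
  synch : ∀ u, (s u).synch = true
  alg : ∀ u, (s u).alg = a u
  Dt : ∀ u, (s u).Dt = ∅
  D : ∀ u, (s u).D = ∅
  mem_P : ∀ u ℓ, ℓ ∈ (s u).P ↔ (G.link u ℓ).isSome
  pulled : ∀ u ℓ w m, G.link u ℓ = some (w, m) → ∃ x, (s u).X ℓ = some x ∧ x.phase = i ∧
    x.algMain = (a w).main ∧ x.algPort = (a w).port m

/-- With equal phases and `synch = 0` everywhere no neighbour is invalid, and no `ack` is visible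
yet, so all nodes acknowledge and none blocks. -/
theorem PhaseStart.pull {G : Snapshot V Δ} {i : ℕ} {a : V → A.State} {s s' : V → KState A}
    (h : PhaseStart i a s) (hstep : StageStep G Set.univ s s') :
    PhasePulled G i a s' ∧ ∀ u ℓ, (s' u).block ℓ = false ∧
      (ℓ ∈ (s' u).P → (s' u).ack ℓ = true) := by
  have hguard : ∀ u, (s u).HandshakeGuard := fun u => Or.inl (h u).2.1
  have hval : ∀ u w m, ¬ KState.Invalid (s u).phase ((s w).exposed m) := by
    intro u w m
    rw [not_invalid_iff (by rw [(h u).1, (h w).1]), (h w).2.1]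
    simp
  have hloop : ∀ u, ((s u).handshakePull (pullFrom G s u)).loopPorts =
      Finset.univ.filter fun ℓ => ((G.link u ℓ).isSome : Prop) := by
    intro u
    ext ℓ
    rcases hl : G.link u ℓ with _ | ⟨w, m⟩
    · simp [KState.loopPorts, KState.handshakePull, (h u).2.1, KState.beginPhase, pullFrom, hl]
    · have hv := hval u w m
      simp only [KState.exposed, (h u).1, (h w).1] at hv
      simp [KState.loopPorts, KState.handshakePull, (h u).2.1, KState.beginPhase, pullFrom, hl,
        hv, KState.exposed, (h u).1, (h w).1, ((h u).2.2.2 ℓ).1]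
  have hblock : ∀ u, ((s u).handshakePull (pullFrom G s u)).blockPorts = ∅ := by
    intro u
    ext ℓ
    simp only [KState.blockPorts, hloop]
    rcases hl : G.link u ℓ with _ | ⟨w, m⟩
    · simp [hl]
    · simp [hl, KState.handshakePull, (h u).2.1, KState.beginPhase, pullFrom, KState.exposed,
        ((h w).2.2.2 m).2]
  have hnb : ∀ u ℓ, ¬ BlockedBy G Set.univ s u ℓ := by
    rintro u ℓ ⟨w, m, -, -, -, hm⟩
    simp [KState.handshakeWrites, hblock] at hm
  have hs' : ∀ u, s' u = { (s u).handshake (pullFrom G s u) with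
      D := ∅
      block := fun ℓ => ((s u).handshake (pullFrom G s u)).block ℓ ||
          decide (BlockedBy G Set.univ s u ℓ) } := by
    intro u
    rcases hstep.node_cases u with ⟨h1, -⟩ | ⟨-, -, h3⟩ | ⟨h1, -⟩
    · exact absurd (Set.mem_univ u) h1
    · exact h3
    · exact absurd (hguard u) (KState.not_handshakeGuard_of_executeGuard h1.2)
  have hP : ∀ u ℓ, ℓ ∈ (s' u).P ↔ (G.link u ℓ).isSome := by
    intro u ℓ
    rcases hl : G.link u ℓ with _ | ⟨w, m⟩ <;>
    simp [hs', KState.handshake, KState.handshakeLoop, KState.handshakePull, (h u).2.1,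
      KState.beginPhase, pullFrom, hl, hval]
  refine ⟨⟨fun u => ?_, fun u => ?_, fun u => ?_, fun u => ?_, fun u => ?_, hP, ?_⟩, fun u ℓ =>
    ⟨?_, ?_⟩⟩
  · simp [hs', KState.handshake_phase, (h u).1]
  · simp [hs', KState.handshake_synch]
  · simp [hs', KState.handshake_alg, (h u).2.2.1]
  · simp [hs', KState.handshake, KState.handshakeLoop, KState.handshakePull, (h u).2.1,
      KState.beginPhase]
  · simp [hs']
  · intro u ℓ w m hl
    refine ⟨(s w).exposed m, ?_, (h w).1, ?_, ?_⟩
    · simp [hs', KState.handshake, KState.handshakeLoop, KState.handshakePull, (h u).2.1,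
        KState.beginPhase, pullFrom, hl]
    · simp [KState.exposed, (h w).2.2.1]
    · simp [KState.exposed, (h w).2.2.1]
  · simp [hs', hnb, KState.handshake, KState.handshakeLoop, KState.handshakePull_block, hblock,
      ((h u).2.2.2 ℓ).1]
  · rw [hP]
    intro hℓ
    simp [hs', KState.handshake, KState.handshakeLoop, hloop, hblock, hℓ]

/-- Activation is restricted to nodes with a true `Handshake` guard because an isolated node is
already able to run `ExecuteSynch` and would leave the common phase. -/
theorem PhasePulled.block {G : Snapshot V Δ} {i : ℕ} {a : V → A.State} {s s' : V → KState A}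
    (h : PhasePulled G i a s) (hack : ∀ u ℓ, (s u).block ℓ = false ∧
      (ℓ ∈ (s u).P → (s u).ack ℓ = true))
    (hstep : StageStep G {u | (s u).HandshakeGuard} s s') :
    PhasePulled G i a s' ∧ ∀ u, ∀ ℓ ∈ (s' u).P, (s' u).block ℓ = true := by
  have hX : ∀ u ℓ w m, G.link u ℓ = some (w, m) → ∃ x,
      ((s u).handshakePull (pullFrom G s u)).X ℓ = some x ∧ x.phase = i ∧ x.ack = true ∧
        x.algMain = (a w).main ∧ x.algPort = (a w).port m := by
    intro u ℓ w m hl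
    obtain ⟨x, hx, hxp, hxa⟩ := h.pulled u ℓ w m hl
    have hP : ℓ ∈ (s u).P := by simp [h.mem_P, hl]
    have hm : (s w).ack m = true :=
      (hack w m).2 (by simp [h.mem_P, G.symm _ _ _ _ hl])
    refine ⟨{ x with ack := true }, ?_, hxp, rfl, hxa⟩
    simp [KState.handshakePull, h.synch, KState.continuePhase, h.Dt, h.D, hP, hx,
      pullFrom_of_link hl, KState.refresh_some, h.phase, hxp, KState.exposed, hm]
  have hlink : ∀ u ℓ, ℓ ∈ (s u).P → ∃ w m, G.link u ℓ = some (w, m) := by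
    intro u ℓ hℓ
    rw [h.mem_P, Option.isSome_iff_exists] at hℓ
    obtain ⟨⟨w, m⟩, hl⟩ := hℓ
    exact ⟨w, m, hl⟩
  have hblock : ∀ u, ∀ ℓ ∈ (s u).P,
      ℓ ∈ ((s u).handshakePull (pullFrom G s u)).blockPorts := by
    intro u ℓ hℓ
    obtain ⟨w, m, hl⟩ := hlink u ℓ hℓ
    obtain ⟨x, hx, hxp, hxa, -⟩ := hX u ℓ w m hl
    simp only [KState.blockPorts, KState.loopPorts, Finset.mem_filter, hx,
      KState.handshakePull_block, KState.handshakePull_phase]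
    refine ⟨⟨?_, ⟨x, rfl, by rw [hxp, h.phase]⟩, (hack u ℓ).1⟩, x, rfl, hxa⟩
    simp [KState.handshakePull, h.synch, KState.continuePhase, h.Dt, h.D, hℓ]
  have hcases : ∀ u, (s' u).phase = i ∧ (s' u).synch = true ∧ (s' u).alg = a u ∧
      (s' u).Dt = ∅ ∧ (s' u).D = ∅ ∧ (s' u).P = (s u).P ∧
      (∀ ℓ w m, G.link u ℓ = some (w, m) → ∃ x, (s' u).X ℓ = some x ∧ x.phase = i ∧
        x.algMain = (a w).main ∧ x.algPort = (a w).port m) ∧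
      ∀ ℓ ∈ (s u).P, (s' u).block ℓ = true := by
    intro u
    rcases hstep.node_cases u with ⟨h1, h2⟩ | ⟨-, -, h3⟩ | ⟨h1, -⟩
    · refine ⟨?_, ?_, ?_, ?_, ?_, ?_, ?_, ?_⟩
      · simp [h2, h.phase]
      · simp [h2, h.synch]
      · simp [h2, h.alg]
      · simp [h2, h.Dt]
      · simp [h2, h.D]
      · simp [h2]
      · simpa [h2] using h.pulled u
      · intro ℓ hℓ
        exact absurd (Or.inr ⟨ℓ, by simp [h.Dt, hℓ], (hack u ℓ).1⟩) h1
    · refine ⟨?_, ?_, ?_, ?_, ?_, ?_, ?_, ?_⟩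
      · simp [h3, KState.handshake_phase, h.phase]
      · simp [h3, KState.handshake_synch]
      · simp [h3, KState.handshake_alg, h.alg]
      · simp [h3, KState.handshake, KState.handshakeLoop, KState.handshakePull, h.synch,
          KState.continuePhase, h.Dt, h.D]
      · simp [h3]
      · simp [h3, KState.handshake, KState.handshakeLoop, KState.handshakePull, h.synch,
          KState.continuePhase]
      · intro ℓ w m hl
        obtain ⟨x, hx, hxp, -, hxa⟩ := hX u ℓ w m hl
        exact ⟨x, by rw [h3]; exact hx, hxp, hxa⟩
      · intro ℓ hℓ
        simp [h3, KState.handshake, KState.handshakeLoop, hblock u ℓ hℓ]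
    · exact absurd h1.1 (KState.not_handshakeGuard_of_executeGuard h1.2)
  refine ⟨⟨fun u => (hcases u).1, fun u => (hcases u).2.1, fun u => (hcases u).2.2.1,
    fun u => (hcases u).2.2.2.1, fun u => (hcases u).2.2.2.2.1, fun u ℓ => ?_,
    fun u => (hcases u).2.2.2.2.2.2.1⟩, fun u ℓ hℓ => ?_⟩
  · rw [(hcases u).2.2.2.2.2.1, h.mem_P]
  · rw [(hcases u).2.2.2.2.2.1] at hℓ
    exact (hcases u).2.2.2.2.2.2.2 ℓ hℓ

theorem PhasePulled.emulatedView {G : Snapshot V Δ} {i : ℕ} {a : V → A.State} {s : V → KState A}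
    (h : PhasePulled G i a s) (hb : ∀ u, ∀ ℓ ∈ (s u).P, (s u).block ℓ = true) (u : V) :
    (s u).emulatedView = A.view G a u := by
  funext ℓ
  simp only [KState.emulatedView, KState.finalPorts, Finset.mem_filter, PullAlgorithm.view]
  rcases hl : G.link u ℓ with _ | ⟨w, m⟩
  · simp [h.mem_P, hl]
  · have hP : ℓ ∈ (s u).P := by simp [h.mem_P, hl]
    obtain ⟨x, hx, -, hm, hp⟩ := h.pulled u ℓ w m hl
    rw [if_pos ⟨hP, hb u ℓ hP⟩, hx]
    simp [hm, hp]

theorem PhasePulled.execute {G : Snapshot V Δ} {i : ℕ} {a a' : V → A.State} {s : V → KState A}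
    (h : PhasePulled G i a s) (hb : ∀ u, ∀ ℓ ∈ (s u).P, (s u).block ℓ = true) :
    PhaseStart (i + 1) a' (stageWith G Set.univ a' s) := by
  have hguard : ∀ u, ¬ (s u).HandshakeGuard := by
    rintro u (hs | ⟨ℓ, hℓ, hbf⟩)
    · simp [h.synch] at hs
    · simp [hb u ℓ (Finset.mem_sdiff.1 hℓ).1] at hbf
  have hnb : ∀ u ℓ, ¬ BlockedBy G Set.univ s u ℓ := by
    rintro u ℓ ⟨w, m, -, -, hg, -⟩
    exact hguard w hg
  intro u
  simp [stageWith, hguard, h.phase, hnb]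

/-- The nodes activated in stage `t`, in the configuration `s`. -/
def roundActive (t : ℕ) (s : V → KState A) : Set V :=
  if t % 3 = 1 then {u | (s u).HandshakeGuard} else Set.univ

/-- The semi-synchronous execution that emulates every step of the synchronous execution `d` in
three stages. -/
noncomputable def roundExecution (H : DynamicNetwork V Δ) (d : ℕ → V → A.State) :
    ℕ → V → KState A
  | 0 => fun u => KState.init (d 0 u)
  | t + 1 => stageWith (H (t / 3)) (roundActive t (roundExecution H d t)) (d (t / 3 + 1))
      (detect (DynamicNetwork.disconnected (fun t => H (t / 3)) t) (roundExecution H d t))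

theorem roundExecution_succ (H : DynamicNetwork V Δ) (d : ℕ → V → A.State) (t : ℕ) :
    roundExecution H d (t + 1) =
      stageWith (H (t / 3)) (roundActive t (roundExecution H d t)) (d (t / 3 + 1))
        (detect (DynamicNetwork.disconnected (fun t => H (t / 3)) t) (roundExecution H d t)) :=
  rfl

theorem detect_of_eq {G : DynamicNetwork V Δ} {t : ℕ} (h : G (t + 1) = G t) (s : V → KState A) :
    detect (G.disconnected (t + 1)) s = s := by
  funext u
  have : G.disconnected (t + 1) u = ∅ := by simp [DynamicNetwork.disconnected, h]
  simp [detect, this]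

section Round

variable {Init : Set (V → A.State)} {H : DynamicNetwork V Δ} {d : ℕ → V → A.State}

/-- The three stages of a phase. -/
theorem roundExecution_phase (hd : A.IsSyncExecution Init H d) (i : ℕ)
    (h : PhaseStart i (d i) (roundExecution H d (3 * i))) :
    (∀ t, t / 3 = i → (∀ u, (roundExecution H d t u).phase = i) ∧
      StageStep (H (t / 3)) (roundActive t (roundExecution H d t))
        (detect (DynamicNetwork.disconnected (fun t => H (t / 3)) t) (roundExecution H d t))
        (roundExecution H d (t + 1))) ∧
    PhaseStart (i + 1) (d (i + 1)) (roundExecution H d (3 * (i + 1))) := by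
  have e0 : 3 * i / 3 = i := by omega
  have e1 : (3 * i + 1) / 3 = i := by omega
  have e2 : (3 * i + 2) / 3 = i := by omega
  have a0 : roundActive (3 * i) (roundExecution H d (3 * i)) = Set.univ := by
    rw [roundActive, if_neg (by omega)]
  have a1 : roundActive (3 * i + 1) (roundExecution H d (3 * i + 1)) =
      {u | (roundExecution H d (3 * i + 1) u).HandshakeGuard} := by
    rw [roundActive, if_pos (by omega)]
  have a2 : roundActive (3 * i + 2) (roundExecution H d (3 * i + 2)) = Set.univ := by
    rw [roundActive, if_neg (by omega)]
  have d1 : ∀ s : V → KState A,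
      detect (DynamicNetwork.disconnected (fun t => H (t / 3)) (3 * i + 1)) s = s :=
    detect_of_eq (by simp only [e0, e1])
  have d2 : ∀ s : V → KState A,
      detect (DynamicNetwork.disconnected (fun t => H (t / 3)) (3 * i + 2)) s = s :=
    detect_of_eq (by simp only [e1, e2])
  -- The snapshot may change before stage `3 * i`. The resulting detections are harmless:
  -- `PhaseStart` does not involve `D`, which is reset in that stage.
  have h' : PhaseStart i (d i)
      (detect (DynamicNetwork.disconnected (fun t => H (t / 3)) (3 * i))
        (roundExecution H d (3 * i))) := h
  have s0 : StageStep (H i) Set.univ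
      (detect (DynamicNetwork.disconnected (fun t => H (t / 3)) (3 * i))
        (roundExecution H d (3 * i))) (roundExecution H d (3 * i + 1)) := by
    rw [roundExecution, e0, a0]
    refine stageStep_stageWith fun u _ hg => ?_
    have := hg.1
    simp [(h' u).2.1] at this
  obtain ⟨p1, q1⟩ := h'.pull s0
  have s1 : StageStep (H i) {u | (roundExecution H d (3 * i + 1) u).HandshakeGuard}
      (roundExecution H d (3 * i + 1)) (roundExecution H d (3 * i + 2)) := by
    have c2 := roundExecution_succ H d (3 * i + 1)
    rw [e1, a1, d1] at c2
    rw [c2]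
    exact stageStep_stageWith fun u hu hg =>
      absurd hu (KState.not_handshakeGuard_of_executeGuard hg)
  obtain ⟨p2, q2⟩ := p1.block q1 s1
  have c3 : roundExecution H d (3 * i + 3) =
      stageWith (H i) Set.univ (d (i + 1)) (roundExecution H d (3 * i + 2)) := by
    rw [roundExecution, e2, a2, d2]
  have s2 : StageStep (H i) Set.univ (roundExecution H d (3 * i + 2))
      (roundExecution H d (3 * i + 3)) := by
    rw [c3]
    refine stageStep_stageWith fun u _ _ => ?_
    rw [p2.emulatedView q2, p2.alg]
    exact hd.2 i u
  refine ⟨fun t ht => ?_, ?_⟩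
  · obtain rfl | rfl | rfl : t = 3 * i ∨ t = 3 * i + 1 ∨ t = 3 * i + 2 := by omega
    · rw [e0, a0]
      exact ⟨fun u => (h u).1, s0⟩
    · rw [e1, a1, d1]
      exact ⟨p1.phase, s1⟩
    · rw [e2, a2, d2]
      exact ⟨p2.phase, s2⟩
  · rw [show 3 * (i + 1) = 3 * i + 3 by ring, c3]
    exact p2.execute q2

theorem phaseStart_roundExecution (hd : A.IsSyncExecution Init H d) (i : ℕ) :
    PhaseStart i (d i) (roundExecution H d (3 * i)) := by
  induction i with
  | zero => simp [PhaseStart, roundExecution, KState.init]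
  | succ i ih => exact (roundExecution_phase hd i ih).2

/-- Every synchronous execution agrees with a weakly fair semi-synchronous execution. -/
theorem PullAlgorithm.IsSyncExecution.exists_semiExecution (hd : A.IsSyncExecution Init H d) :
    ∃ (G : DynamicNetwork V Δ) (active : ℕ → Set V) (c : ℕ → V → KState A),
      IsSemiExecution Init G active c ∧ WeaklyFair active c ∧ SameOutcome c d := by
  have hphase := fun t =>
    (roundExecution_phase hd (t / 3) (phaseStart_roundExecution hd (t / 3))).1 t rfl
  refine ⟨fun t => H (t / 3), fun t => roundActive t (roundExecution H d t), roundExecution H d,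
    ⟨⟨d 0, hd.1, rfl⟩, fun t u _ => KState.enabled _, fun t => (hphase t).2⟩, ?_, ?_, ?_⟩
  · intro u t _
    -- All nodes are activated in stages divisible by 3.
    refine ⟨3 * t, by omega, ?_⟩
    dsimp only
    rw [roundActive, if_neg (by omega)]
    exact Set.mem_univ u
  · intro u
    rfl
  · refine fun i u => ⟨⟨3 * i + 2, ?_, ?_⟩, fun t ht => ?_⟩
    · rw [(hphase _).1]
      omega
    · rw [(hphase _).1]
      omega
    · have h1 := ht.1
      have h2 := ht.2
      rw [(hphase _).1] at h1 h2
      obtain rfl : t = 3 * i + 2 := by omega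
      exact (phaseStart_roundExecution hd (i + 1) u).2.2.1

end Round

/-! ## Termination -/

theorem PullAlgorithm.IsSyncExecution.eq_of_halted {Init : Set (V → A.State)}
    {H : DynamicNetwork V Δ} {d : ℕ → V → A.State} (hd : A.IsSyncExecution Init H d) {i j : ℕ}
    (hij : i ≤ j) {u : V} (h : A.Halted (d i u)) : d j u = d i u := by
  induction j, hij using Nat.le_induction with
  | base => rfl
  | succ k hk ih =>
    rcases hd.2 k u with ⟨a, ha, -⟩ | ⟨-, hk⟩
    · rw [ih] at ha
      exact absurd ha (h a)
    · rw [hk, ih]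

/-- Agreement speaks only of the ends of phases. Since `A`-states change only there, it determines
the `A`-state in every stage, which is what comparing termination needs. -/
theorem IsSemiExecution.alg_eq_of_sameOutcome {Init : Set (V → A.State)} {G : DynamicNetwork V Δ}
    {active : ℕ → Set V} {c : ℕ → V → KState A} (hc : IsSemiExecution Init G active c)
    {d : ℕ → V → A.State} (h : SameOutcome c d) (t : ℕ) (u : V) :
    (c t u).alg = d (c t u).phase u := by
  induction t with
  | zero => rw [hc.phase_zero, h.1]
  | succ t ih =>
    by_cases he : Executes (active t) (stageConfig G c t) u
    · rw [hc.executes_iff] at he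
      rw [he]
      exact (h.2 _ u).2 t ⟨rfl, he⟩
    · have h2 := ((hc.stage t).phase_of_not_executes he).2
      rw [hc.not_executes_iff] at he
      rw [he, ← ih]
      exact h2

end Synchronizer

theorem mainTheorem5 {V : Type v} [Finite V] {Δ : ℕ} (A : PullAlgorithm.{u} Δ)
    (Init : Set (V → A.State)) :
    SyncAlwaysTerminates A Init ↔
      (CorrectlyEmulates A Init ∧ SemiAlwaysTerminates A Init) := by
  have hbdd : ∀ f : V → ℕ, ∃ n, ∀ u, f u ≤ n := fun f =>
    (Set.finite_range f).bddAbove.imp fun n hn u => hn ⟨u, rfl⟩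
  constructor
  · intro hterm
    refine ⟨⟨fun G active c hc hf => hc.exists_syncExecution hf,
      fun H d hd => hd.exists_semiExecution⟩, fun G active c hc hf => ?_⟩
    obtain ⟨H, d, hd, hcd⟩ := hc.exists_syncExecution hf
    obtain ⟨i, hi⟩ := hterm H d hd
    choose τ hτ using hc.exists_le_phase hf i
    obtain ⟨n, hn⟩ := hbdd τ
    refine ⟨n, fun u => ?_⟩
    rw [hc.alg_eq_of_sameOutcome hcd,
      hd.eq_of_halted ((hτ u).trans (hc.phase_mono u (hn u))) (hi u)]
    exact hi u
  · rintro ⟨⟨-, hemul⟩, hterm⟩ H d hd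
    obtain ⟨G, active, c, hc, hf, hcd⟩ := hemul H d hd
    obtain ⟨t, ht⟩ := hterm G active c hc hf
    -- At stage `t` the nodes may be in different phases. Each is halted at the step given by its
    -- own phase, hence also at the common later step `n`.
    obtain ⟨n, hn⟩ := hbdd fun u => (c t u).phase
    refine ⟨n, fun u => ?_⟩
    have hu := ht u
    rw [hc.alg_eq_of_sameOutcome hcd] at hu
    rw [hd.eq_of_halted (hn u) hu]
    exact hu
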